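/- Let $(X,\|\cdot\|)$ be a normed plane, i.e. a two-dimensional real normed space, whose unit circle $S=\{x:\|x\|=1\}$ is of class $C^2$ and contains no line segment. Fix a nondegenerate alternating bilinear form $[\cdot,\cdot]$ on $X$; it fixes area and orientation. The anti-norm is $\|x\|_a=\sup\{|[x,y]|:y\in S\}$, and the unit anti-circle is $S_a=\{x:\|x\|_a=1\}$. Lengths of curves are measured in the norm $\|\cdot\|$. Let $\varphi:\mathbb{R}\to S$ and $\sigma:\mathbb{R}\to S$ be the (periodically extended) positively oriented parametrizations of $S$ by twice the area of sectors, so that $\int_a^b[\varphi,\varphi']=b-a$ for all $a,b$, and by arc length, respectively. For a curve $\gamma:[0,l]\to X$ parametrized by arc length write $\gamma'(s)=\varphi(u(s))=\sigma(t(s))$ with differentiable functions $u,t$ whenever this is possible; the Minkowski curvature of $\gamma$ at $\gamma(s)$ is $k_m(s)=u'(s)$, and the arc-length curvature is $k_l(s)=t'(s)$. Theorem 6.2. (1) If $S$, parametrized by arc length as a simple closed curve, has constant Minkowski curvature, then the plane is Euclidean, i.e. $(X,\|\cdot\|)$ is linearly isometric to $\mathbb{R}^2$ with the Euclidean norm.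 (2) If $S_a$, parametrized by arc length as a simple closed curve, has constant arc-length curvature, then the plane is Euclidean. -/

import Mathlib

/-! Curvatures of curves in a normed plane `X` with a fixed determinant form `ω`. -/

open Set

namespace NormedPlane

variable {X : Type*} [NormedAddCommGroup X] [NormedSpace ℝ X]

/-- The unit circle `S = {x : ‖x‖ = 1}` of the plane. -/
def unitCircle (X : Type*) [NormedAddCommGroup X] : Set X :=
  {x | ‖x‖ = 1}

/-- The anti-norm `‖x‖ₐ = sup {|[x, y]| : y ∈ S}` with respect to the determinant form `ω`.
In finite dimension this is a supremum of a bounded set. -/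
noncomputable def antiNorm (ω : LinearMap.BilinForm ℝ X) (x : X) : ℝ :=
  sSup ((fun y => |ω x y|) '' unitCircle X)

/-- The unit anti-circle: the unit circle of the anti-norm. -/
def unitAntiCircle (ω : LinearMap.BilinForm ℝ X) : Set X :=
  {x | antiNorm ω x = 1}

/-- `φ` is a positively oriented `C¹` parametrization of the unit circle by twice the area of
sectors, extended periodically to `ℝ`: twice the signed `ω`-area of the sector swept between the
parameters `a` and `b` is `∫ [φ, φ']`, and it equals `b - a`. -/
structure IsAreaParametrization (ω : LinearMap.BilinForm ℝ X) (φ : ℝ → X) : Prop where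
  contDiff : ContDiff ℝ 1 φ
  range_eq : range φ = unitCircle X
  sector_area : ∀ a b : ℝ, ∫ t in a..b, ω (φ t) (deriv φ t) = b - a

/-- `φ` is a positively oriented `C¹` parametrization of the unit circle by the arc length of
the norm (length being the supremum over partitions), extended periodically to `ℝ`. -/
structure IsArcLengthParametrization (ω : LinearMap.BilinForm ℝ X) (φ : ℝ → X) : Prop where
  contDiff : ContDiff ℝ 1 φ
  range_eq : range φ = unitCircle X
  unitSpeed : HasUnitSpeedOn φ univ
  positive : ∀ t : ℝ, 0 < ω (φ t) (deriv φ t)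

/-- `k` is the Minkowski curvature function of the curve `γ : [0, l] → X`, which is parametrized
by arc length: `γ'(s) = φ(u(s))` and `k(s) = u'(s)`, where `φ` is the parametrization of the unit
circle by twice the area of sectors. Two choices of `φ` differ by a shift of the parameter, so
`k` does not depend on `φ`. -/
def IsMinkowskiCurvature (ω : LinearMap.BilinForm ℝ X) (γ : ℝ → X) (l : ℝ) (k : ℝ → ℝ) : Prop :=
  HasUnitSpeedOn γ (Icc 0 l) ∧
  ∃ φ : ℝ → X, IsAreaParametrization ω φ ∧ ∃ u : ℝ → ℝ, ∀ s ∈ Icc 0 l,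
    HasDerivWithinAt γ (φ (u s)) (Icc 0 l) s ∧ HasDerivWithinAt u (k s) (Icc 0 l) s

/-- `k` is the arc-length curvature function of the curve `γ : [0, l] → X`, which is parametrized
by arc length: `γ'(s) = φ(t(s))` and `k(s) = t'(s)`, where `φ` is the parametrization of the unit
circle by arc length. -/
def IsArcLengthCurvature (ω : LinearMap.BilinForm ℝ X) (γ : ℝ → X) (l : ℝ) (k : ℝ → ℝ) : Prop :=
  HasUnitSpeedOn γ (Icc 0 l) ∧
  ∃ φ : ℝ → X, IsArcLengthParametrization ω φ ∧ ∃ t : ℝ → ℝ, ∀ s ∈ Icc 0 l,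
    HasDerivWithinAt γ (φ (t s)) (Icc 0 l) s ∧ HasDerivWithinAt t (k s) (Icc 0 l) s

/-- `γ : [0, l] → X` traverses the simple closed curve `C` once. -/
structure IsSimpleClosedCurve (C : Set X) (γ : ℝ → X) (l : ℝ) : Prop where
  image_eq : γ '' Icc 0 l = C
  closed : γ 0 = γ l
  injOn : InjOn γ (Ico 0 l)

/-- The simple closed curve `C` has constant Minkowski curvature. -/
def HasConstantMinkowskiCurvature (ω : LinearMap.BilinForm ℝ X) (C : Set X) : Prop :=
  ∃ (γ : ℝ → X) (l k : ℝ), IsSimpleClosedCurve C γ l ∧ IsMinkowskiCurvature ω γ l (fun _ => k)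

/-- The simple closed curve `C` has constant arc-length curvature. -/
def HasConstantArcLengthCurvature (ω : LinearMap.BilinForm ℝ X) (C : Set X) : Prop :=
  ∃ (γ : ℝ → X) (l k : ℝ), IsSimpleClosedCurve C γ l ∧ IsArcLengthCurvature ω γ l (fun _ => k)

/-- The normed plane is Euclidean: it is linearly isometric to `ℝ²` with the Euclidean norm. -/
def IsEuclidean (X : Type*) [NormedAddCommGroup X] [NormedSpace ℝ X] : Prop :=
  Nonempty (X ≃ₗᵢ[ℝ] EuclideanSpace ℝ (Fin 2))

end NormedPlane

/-!
Let `[·, ·]` be the form `ω`, and let `w` be the tangent field of the norm, `[z, w x] = d‖·‖ₓ z`.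
It is tangent to the unit circle `S` and maps `S` to the anti-circle, whose tangent at `w x` has the
direction `x`.

Integrating `γ' = φ(u₀ + k s)` shows that a closed curve of constant curvature extends to an
antiperiodic curve `ψ : ℝ → X` with `ψ' = φ / k`, where `φ` runs along `S` with half period `T`
(`exists_antiperiodic_extension`). In both cases of the theorem, `ψ` and the tangent field
give a positive function which satisfies a linear equation of the second order on the circle, and
the isoperimetric inequality forces it to be constant. The form of that inequality used here is a
Wirtinger inequality: if `c'' = -ρ c` is a plane curve with half period `T`, then
`∫ D (D'' + ρ D) ≤ 0` over `[a, a + T]` for every function `D` that vanishes at both end points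
(`IsHalfPeriod.integral_mul_nonpos`, by Picone's identity with the coordinate `[c a, c t]`).

*Minkowski curvature* (`isEuclidean_of_mem_unitCircle`). Here `ψ` lies on `S`, `φ` is the
parametrization by area, and `φ'' = -ρ φ`. The function `H = [ψ, φ]` satisfies `H'' + ρ H = 1 / k`.
Writing `ψ = φ ∘ τ`, one finds `τ' = H / k` and `ρ ∘ τ = k / H³`, so that the mean value of `H` is
`k` and `∫ ρ = ∫ 1 / H²`. For `D = H - k`, started at a point where `H = k`, the integral in the
Wirtinger inequality equals `∫ (H - k)² (2 H + k) / (k H²)`, and therefore `H = k`.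

*Arc-length curvature* (`isEuclidean_of_hasDerivAt_tangentField`). Here `ψ` lies on the anti-circle,
`φ` is the arc-length parametrization `σ`, and `ψ = -w ∘ σ` if `k > 0`. The function
`R = ‖w ∘ σ‖` satisfies `R'' = -1 / k + τ' / (k² R)`, where `σ' = σ ∘ τ` and
`τ' = (R ∘ τ) / (k R²)`. For `D = R - r` with any value `r` of `R`, the Wirtinger inequality for
`w ∘ σ` says that `T - 2 k T r + k J r² ≤ 0`, where `J = ∫ 1 / R`. On the other hand, the
substitution `τ` gives `∫ 1 / R² = k J`, so the integral of this polynomial in `R`, weighted with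
`1 / R²`, is zero. Hence all values of `R` are roots of one quadratic polynomial, and `R` is
constant.

In both cases the parametrization of `S` then satisfies `φ'' = -κ² φ` with a constant `κ`, and `S`
is an ellipse (`isEuclidean_of_harmonic`).
-/

open Filter Topology MeasureTheory

namespace NormedPlane

variable {X : Type*} [NormedAddCommGroup X] [NormedSpace ℝ X]

/-! ### The determinant form -/

section Form

variable {ω : LinearMap.BilinForm ℝ X}

lemma form_swap (halt : ω.IsAlt) (x y : X) : ω x y = -ω y x := by
  exact (LinearMap.BilinForm.IsAlt.neg_eq halt y x).symm

/-- The three-term identity expressing that any three vectors of a plane are dependent. -/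
lemma form_expansion (hdim : Module.finrank ℝ X = 2) (halt : ω.IsAlt) (x y z : X) :
    ω y z • x + ω z x • y + ω x y • z = 0 := by
  have : FiniteDimensional ℝ X := FiniteDimensional.of_finrank_pos (by omega)
  let b := Module.finBasisOfFinrankEq ℝ X hdim
  have h0 := halt (b 0)
  have h1 := halt (b 1)
  have h10 := form_swap halt (b 1) (b 0)
  rw [← b.sum_repr x, ← b.sum_repr y, ← b.sum_repr z]
  simp only [Fin.sum_univ_two, map_add, map_smul, LinearMap.add_apply, LinearMap.smul_apply,
    smul_eq_mul, h0, h1, h10]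
  module

lemma eq_or_eq_neg_of_form_eq_zero (hdim : Module.finrank ℝ X = 2) (halt : ω.IsAlt)
    (hnd : ω.Nondegenerate) {x y : X} (hx : ‖x‖ = 1) (hy : ‖y‖ = 1) (h : ω x y = 0) :
    x = y ∨ x = -y := by
  have hx0 : x ≠ 0 := by rintro rfl; simp at hx
  obtain ⟨z, hz⟩ : ∃ z, ω x z ≠ 0 := by
    by_contra! hc
    exact hx0 (hnd.1 x hc)
  have e := form_expansion hdim halt x y z
  rw [h, zero_smul, add_zero] at e
  have e2 : y = (ω y z / ω x z) • x := by
    have hzx : ω z x = -ω x z := form_swap halt z x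
    rw [hzx] at e
    have : ω x z • y = ω y z • x := by
      rw [neg_smul, add_neg_eq_zero] at e; exact e.symm
    rw [div_eq_inv_mul, mul_smul, ← this, smul_smul, inv_mul_cancel₀ hz, one_smul]
  have e3 : |ω y z / ω x z| = 1 := by
    have := congrArg norm e2
    rw [norm_smul, hx, hy, mul_one, Real.norm_eq_abs] at this
    exact this.symm
  rcases (abs_eq (by norm_num)).1 e3 with e4 | e4
  · left; rw [e2, e4, one_smul]
  · right; rw [e2, e4, neg_one_smul, neg_neg]

variable [FiniteDimensional ℝ X]

lemma hasDerivAt_form {f g : ℝ → X} {f' g' : X} {t : ℝ} (hf : HasDerivAt f f' t)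
    (hg : HasDerivAt g g' t) :
    HasDerivAt (fun s => ω (f s) (g s)) (ω f' (g t) + ω (f t) g') t := by
  have h := (ω.toContinuousBilinearMap.isBoundedBilinearMap.hasFDerivAt (f t, g t)).comp_hasDerivAt
    t (hf.prodMk hg)
  exact h.congr_deriv (add_comm _ _)

lemma continuous_form {f g : ℝ → X} (hf : Continuous f) (hg : Continuous g) :
    Continuous fun s => ω (f s) (g s) :=
  ω.toContinuousBilinearMap.isBoundedBilinearMap.continuous.comp (hf.prodMk hg)

end Form

/-! ### The tangent field of the norm -/

/-- `w` is the tangent field of the norm: `w x` is the vector representing the differential of the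
norm at `x` through the form `ω`, that is `[z, w x] = d‖·‖ₓ z`. On the unit circle it is tangent to
the circle, points in the positive direction, satisfies `[x, w x] = 1` and has anti-norm `1`. The
value of `w` at the origin, where the norm is not differentiable, plays no role. -/
structure IsTangentField (ω : LinearMap.BilinForm ℝ X) (w : X → X) : Prop where
  form_right : ∀ x z : X, ω z (w x) = fderiv ℝ (fun y : X => ‖y‖) x z
  contDiffAt_norm : ∀ x : X, x ≠ 0 → ContDiffAt ℝ 2 (fun y : X => ‖y‖) x
  contDiffAt : ∀ x : X, x ≠ 0 → ContDiffAt ℝ 1 w x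
  smul_pos : ∀ (c : ℝ) (x : X), 0 < c → w (c • x) = w x
  neg : ∀ x : X, w (-x) = -w x

section TangentField

variable {ω : LinearMap.BilinForm ℝ X} {w : X → X}

lemma exists_isTangentField (hdim : Module.finrank ℝ X = 2)
    (hC2 : ∀ x : X, x ≠ 0 → ContDiffAt ℝ 2 (fun y : X => ‖y‖) x)
    (halt : ω.IsAlt) (hnd : ω.Nondegenerate) : ∃ w, IsTangentField ω w := by
  have : Nontrivial X := Module.nontrivial_of_finrank_pos (R := ℝ) (by omega)
  obtain ⟨a, ha⟩ := exists_ne (0 : X)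
  obtain ⟨b, hb⟩ : ∃ b, ω a b ≠ 0 := by
    by_contra! hc
    exact ha (hnd.1 a hc)
  refine ⟨fun x => (ω a b)⁻¹ • (fderiv ℝ (fun y : X => ‖y‖) x a • b -
    fderiv ℝ (fun y : X => ‖y‖) x b • a), ?_, hC2, ?_, ?_, ?_⟩
  · intro x z
    have e := congrArg (fderiv ℝ (fun y : X => ‖y‖) x) (form_expansion hdim halt a b z)
    have hbz := form_swap halt b z
    simp only [map_add, map_smul, map_zero, smul_eq_mul, map_sub] at e ⊢
    field_simp
    rw [hbz] at e
    linarith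
  · intro x hx
    have h := (hC2 x hx).fderiv_right (m := 1) (by norm_num)
    exact contDiffAt_const.smul (((h.clm_apply contDiffAt_const).smul contDiffAt_const).sub
      ((h.clm_apply contDiffAt_const).smul contDiffAt_const))
  · intro c x hc
    simp only [fderiv_norm_smul_pos hc]
  · intro x
    have h : fderiv ℝ (fun y : X => ‖y‖) (-x) = -fderiv ℝ (fun y : X => ‖y‖) x := by
      have := fderiv_norm_smul_neg (x := x) (t := (-1 : ℝ)) (by norm_num)
      rwa [neg_one_smul] at this
    simp only [h, neg_apply]
    module

namespace IsTangentField

variable (hw : IsTangentField ω w)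
include hw

lemma hasFDerivAt_norm {x : X} (hx : x ≠ 0) :
    HasFDerivAt (fun y : X => ‖y‖) (fderiv ℝ (fun y : X => ‖y‖) x) x :=
  ((hw.contDiffAt_norm x hx).differentiableAt (by norm_num)).hasFDerivAt

lemma form_self {x : X} (hx : x ≠ 0) : ω x (w x) = ‖x‖ := by
  rw [hw.form_right]
  exact (hw.hasFDerivAt_norm hx).differentiableAt.fderiv_norm_self

lemma ne_zero {x : X} (hx : x ≠ 0) : w x ≠ 0 := by
  intro h
  have := hw.form_self hx
  rw [h, map_zero] at this
  exact hx (norm_eq_zero.1 this.symm)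

lemma hasDerivAt_norm {f : ℝ → X} {f' : X} {t : ℝ} (hf : HasDerivAt f f' t) (h0 : f t ≠ 0) :
    HasDerivAt (fun s => ‖f s‖) (ω f' (w (f t))) t := by
  rw [hw.form_right]
  exact (hw.hasFDerivAt_norm h0).comp_hasDerivAt t hf

lemma hasDerivAt_comp {f : ℝ → X} {f' : X} {t : ℝ} (hf : HasDerivAt f f' t) (h0 : f t ≠ 0) :
    HasDerivAt (fun s => w (f s)) (fderiv ℝ w (f t) f') t :=
  ((hw.contDiffAt _ h0).differentiableAt (by norm_num)).hasFDerivAt.comp_hasDerivAt t hf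

/-- The velocity of a curve on the unit circle is a multiple of the tangent field. -/
lemma velocity_eq (hdim : Module.finrank ℝ X = 2) (halt : ω.IsAlt) {f : ℝ → X} {f' : X}
    (hS : ∀ s, ‖f s‖ = 1) {t : ℝ} (hf : HasDerivAt f f' t) : f' = ω (f t) f' • w (f t) := by
  have h0 : f t ≠ 0 := by
    intro h
    have := hS t
    simp [h] at this
  have h1 : ω f' (w (f t)) = 0 := by
    refine (hw.hasDerivAt_norm hf h0).unique ?_
    simp only [hS]
    exact hasDerivAt_const t 1
  have e := form_expansion hdim halt (f t) (w (f t)) f'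
  rw [form_swap halt (w (f t)), h1, hw.form_self h0, hS, form_swap halt f' (f t), neg_zero,
    zero_smul, zero_add, one_smul, neg_smul] at e
  exact (neg_add_eq_zero.1 e).symm

variable [FiniteDimensional ℝ X]

/-- The derivative of the tangent field at `x` takes values in the line spanned by `x`: the
anti-circle is tangent at `w x` to the direction `x`. -/
lemma fderiv_eq (hdim : Module.finrank ℝ X = 2) (halt : ω.IsAlt) {x : X} (hx : ‖x‖ = 1) (v : X) :
    fderiv ℝ w x v = -ω (w x) (fderiv ℝ w x v) • x := by
  have h0 : x ≠ 0 := by rintro rfl; simp at hx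
  -- differentiate `[y, w y] = ‖y‖` at `x` in the direction `v`
  have hl : HasDerivAt (fun s : ℝ => x + s • v) v 0 := by
    simpa using ((hasDerivAt_id (0 : ℝ)).smul_const v).const_add x
  have hl0 : x + (0 : ℝ) • v = x := by simp
  have h0' : x + (0 : ℝ) • v ≠ 0 := by rwa [hl0]
  have h1 := hasDerivAt_form (ω := ω) hl (hw.hasDerivAt_comp hl h0')
  have h2 := hw.hasDerivAt_norm hl h0'
  have h3 : (fun s : ℝ => ω (x + s • v) (w (x + s • v))) =ᶠ[𝓝 0] fun s => ‖x + s • v‖ := by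
    filter_upwards [hl.continuousAt.eventually_ne h0'] with s hs using hw.form_self hs
  have h4 := h1.unique (h2.congr_of_eventuallyEq h3)
  simp only [hl0, add_eq_left] at h4
  have e := form_expansion hdim halt x (w x) (fderiv ℝ w x v)
  rw [form_swap halt _ x, h4, neg_zero, zero_smul, add_zero, hw.form_self h0, hx, one_smul] at e
  rw [neg_smul]
  exact (neg_eq_of_add_eq_zero_right e).symm

end IsTangentField

end TangentField

/-! ### Curves that follow a vector field -/

section Flow

/-- Uniqueness of the solutions of `f' = h(t) F(f)`, where `F` is `C¹` away from the origin. -/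
lemma eq_of_hasDerivAt_smul {F : X → X} (hF : ∀ x, x ≠ 0 → ContDiffAt ℝ 1 F x) {h : ℝ → ℝ}
    (hh : Continuous h) {f g : ℝ → X} (hf : ∀ t, HasDerivAt f (h t • F (f t)) t)
    (hg : ∀ t, HasDerivAt g (h t • F (g t)) t) (hf0 : ∀ t, f t ≠ 0) {a : ℝ} (hfg : f a = g a) :
    f = g := by
  have hfc : Continuous f := continuous_iff_continuousAt.2 fun t => (hf t).continuousAt
  have hgc : Continuous g := continuous_iff_continuousAt.2 fun t => (hg t).continuousAt
  have hcl : IsClopen {t | f t = g t} := by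
    refine ⟨isClosed_eq hfc hgc, isOpen_iff_mem_nhds.2 fun t (ht : f t = g t) => ?_⟩
    obtain ⟨K, U, hU, hK⟩ := (hF (f t) (hf0 t)).exists_lipschitzOnWith
    have hM : ∀ᶠ s in 𝓝 t, ‖h s‖₊ < ‖h t‖₊ + 1 :=
      hh.nnnorm.continuousAt.eventually_lt_const (lt_add_one _)
    refine ODE_solution_unique_of_eventually (v := fun s x => h s • F x) (s := fun _ => U)
      (K := (‖h t‖₊ + 1) * K) ?_ ?_ ?_ ht
    · filter_upwards [hM] with s hs
      refine LipschitzOnWith.of_dist_le_mul fun x hx y hy => ?_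
      have h1 := hK.dist_le_mul x hx y hy
      have h2 : ‖h s‖ ≤ ‖h t‖ + 1 := by exact_mod_cast hs.le
      rw [dist_smul₀, NNReal.coe_mul, mul_assoc]
      exact mul_le_mul (by simpa using h2) h1 dist_nonneg (by positivity)
    · filter_upwards [hfc.continuousAt.preimage_mem_nhds hU] with s hs using ⟨hf s, hs⟩
    · filter_upwards [hgc.continuousAt.preimage_mem_nhds (ht ▸ hU)] with s hs using ⟨hg s, hs⟩
  have := hcl.eq_univ ⟨a, hfg⟩
  funext t
  exact (this ▸ mem_univ t : t ∈ {t | f t = g t})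

variable {ω : LinearMap.BilinForm ℝ X}

/-- `φ` runs along the unit circle with velocity `F (φ t)`, in the positive direction, where `F`
is an odd vector field. -/
structure IsCircleFlow (ω : LinearMap.BilinForm ℝ X) (F : X → X) (φ : ℝ → X) : Prop where
  contDiffAt : ∀ x : X, x ≠ 0 → ContDiffAt ℝ 1 F x
  neg : ∀ x : X, F (-x) = -F x
  hasDerivAt : ∀ t, HasDerivAt φ (F (φ t)) t
  range_eq : range φ = unitCircle X
  positive : ∀ t, 0 < ω (φ t) (F (φ t))

/-- `T` is the half period of `φ`: after the time `T` the curve is at the antipode, and before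
that time it is on the positive side of its starting point. -/
structure IsHalfPeriod (ω : LinearMap.BilinForm ℝ X) (φ : ℝ → X) (T : ℝ) : Prop where
  pos : 0 < T
  antiperiodic : Function.Antiperiodic φ T
  form_pos : ∀ a t, 0 < t → t < T → 0 < ω (φ a) (φ (a + t))

namespace IsCircleFlow

variable {F : X → X} {φ : ℝ → X} (hφ : IsCircleFlow ω F φ)
include hφ

lemma norm_eq_one (t : ℝ) : ‖φ t‖ = 1 := by
  have : φ t ∈ unitCircle X := hφ.range_eq ▸ mem_range_self t
  exact this

lemma ne_zero (t : ℝ) : φ t ≠ 0 := by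
  intro h
  have := hφ.norm_eq_one t
  simp [h] at this

lemma continuous : Continuous φ :=
  continuous_iff_continuousAt.2 fun t => (hφ.hasDerivAt t).continuousAt

lemma eq_add {a b : ℝ} (h : φ a = φ b) (t : ℝ) : φ (a + t) = φ (b + t) := by
  refine congrFun (eq_of_hasDerivAt_smul (f := fun t => φ (a + t)) (g := fun t => φ (b + t))
    hφ.contDiffAt (continuous_const (y := (1 : ℝ))) (fun t => ?_) (fun t => ?_)
    (fun t => hφ.ne_zero _) (a := 0) (by simpa using h)) t
  · rw [one_smul]; exact (hφ.hasDerivAt (a + t)).comp_const_add a t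
  · rw [one_smul]; exact (hφ.hasDerivAt (b + t)).comp_const_add b t

lemma eq_neg_add {a b : ℝ} (h : φ a = -φ b) (t : ℝ) : φ (a + t) = -φ (b + t) := by
  refine congrFun (eq_of_hasDerivAt_smul (f := fun t => φ (a + t)) (g := fun t => -φ (b + t))
    hφ.contDiffAt (continuous_const (y := (1 : ℝ))) (fun t => ?_) (fun t => ?_)
    (fun t => hφ.ne_zero _) (a := 0) (by simpa using h)) t
  · rw [one_smul]; exact (hφ.hasDerivAt (a + t)).comp_const_add a t
  · rw [one_smul, hφ.neg]; exact ((hφ.hasDerivAt (b + t)).comp_const_add b t).neg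

lemma exists_isHalfPeriod [FiniteDimensional ℝ X] (hdim : Module.finrank ℝ X = 2) (halt : ω.IsAlt)
    (hnd : ω.Nondegenerate) : ∃ T, IsHalfPeriod ω φ T := by
  have hne : φ 0 ≠ -φ 0 := by
    intro h
    have h2 : (2 : ℝ) • φ 0 = 0 := by rw [two_smul, ← eq_neg_iff_add_eq_zero]; exact h
    exact hφ.ne_zero 0 ((smul_eq_zero.1 h2).resolve_left two_ne_zero)
  -- the first nonnegative time at which `φ` reaches the antipode of `φ 0`
  let Z := {t : ℝ | 0 ≤ t ∧ φ t = -φ 0}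
  have hZc : IsClosed Z :=
    (isClosed_le continuous_const continuous_id).inter (isClosed_eq hφ.continuous continuous_const)
  have hZb : BddBelow Z := ⟨0, fun t ht => ht.1⟩
  have hZn : Z.Nonempty := by
    have h1 : -φ 0 ∈ range φ := by
      rw [hφ.range_eq]
      change ‖-φ 0‖ = 1
      rw [norm_neg, hφ.norm_eq_one]
    obtain ⟨s, hs⟩ := h1
    rcases le_total 0 s with h | h
    · exact ⟨s, h, hs⟩
    · refine ⟨-s, by linarith, ?_⟩
      have := hφ.eq_neg_add hs (-s)
      simp only [add_neg_cancel, zero_add] at this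
      rw [this, neg_neg]
  have hT := hZc.csInf_mem hZn hZb
  set T := sInf Z with hTdef
  have hmin : ∀ t, 0 ≤ t → t < T → φ t ≠ -φ 0 := fun t h0 h1 h2 =>
    absurd (csInf_le hZb (show t ∈ Z from ⟨h0, h2⟩)) (not_le.2 h1)
  have hTpos : 0 < T := by
    refine lt_of_le_of_ne hT.1 fun h => hne ?_
    conv_lhs => rw [h]
    exact hT.2
  have hnz : ∀ a t, 0 < t → t < T → ω (φ a) (φ (a + t)) ≠ 0 := by
    intro a t h0 h1 h2
    rcases eq_or_eq_neg_of_form_eq_zero hdim halt hnd (hφ.norm_eq_one _) (hφ.norm_eq_one _) h2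
      with h | h
    · -- a return to the starting point at time `t` gives an antipodal point at time `T - t`
      have h3 := hφ.eq_add h (-a + (T - t))
      have h4 : a + t + (-a + (T - t)) = T := by ring
      have h5 : a + (-a + (T - t)) = T - t := by ring
      rw [h4, h5, hT.2] at h3
      exact hmin (T - t) (by linarith) (by linarith) h3
    · have h3 := hφ.eq_neg_add h (-a)
      have h4 : a + t + -a = t := by ring
      rw [h4, add_neg_cancel] at h3
      refine hmin t h0.le h1 ?_
      rw [h3, neg_neg]
  refine ⟨T, hTpos, fun t => ?_, fun a t h0 h1 => ?_⟩
  · have := hφ.eq_neg_add hT.2 t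
    rwa [zero_add, add_comm] at this
  · -- `[φ a, φ (a + t)]` vanishes at `t = 0` with positive derivative, and has no further zero
    have hd : HasDerivAt (fun t => ω (φ a) (φ (a + t))) (ω (φ a) (F (φ a))) 0 := by
      have h2 : HasDerivAt (fun t => φ (a + t)) (F (φ a)) 0 := by
        simpa using (hφ.hasDerivAt (a + 0)).comp_const_add a 0
      simpa using hasDerivAt_form (ω := ω) (hasDerivAt_const (0 : ℝ) (φ a)) h2
    have hc : Continuous fun t => ω (φ a) (φ (a + t)) :=
      continuous_form continuous_const (hφ.continuous.comp (continuous_const.add continuous_id))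
    have hzero : ω (φ a) (φ (a + 0)) = 0 := by rw [add_zero]; exact halt _
    obtain ⟨s, hs, hs0, hst⟩ : ∃ s, 0 < ω (φ a) (φ (a + s)) ∧ 0 < s ∧ s < t := by
      have h3 := hd.tendsto_slope.eventually_const_lt (hφ.positive a)
      have h4 : ∀ᶠ s in 𝓝[>] (0 : ℝ), 0 < slope (fun t => ω (φ a) (φ (a + t))) 0 s :=
        h3.filter_mono (nhdsWithin_mono _ fun x (hx : 0 < x) => hx.ne')
      obtain ⟨s, hs, hs'⟩ := (h4.and (Ioo_mem_nhdsGT h0)).exists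
      refine ⟨s, ?_, hs'.1, hs'.2⟩
      rw [slope_def_field, hzero, sub_zero, sub_zero] at hs
      exact (div_pos_iff_of_pos_right hs'.1).1 hs
    by_contra hneg
    obtain ⟨r, hr, hr0⟩ := intermediate_value_Icc' hst.le hc.continuousOn
      (show (0 : ℝ) ∈ Icc _ _ from ⟨not_lt.1 hneg, hs.le⟩)
    exact hnz a r (by linarith [hr.1]) (by linarith [hr.2]) hr0

end IsCircleFlow

end Flow

/-! ### Reparametrization by a lift -/

section Lift

variable {ω : LinearMap.BilinForm ℝ X}

/-- A continuous function that avoids the multiples of `T` oscillates by less than `T`. -/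
lemma abs_sub_lt_of_forall_ne_int_mul {f : ℝ → ℝ} (hf : Continuous f) {T : ℝ} (hT : 0 < T)
    (h : ∀ t, ∀ n : ℤ, f t ≠ n * T) (a b : ℝ) : |f a - f b| < T := by
  let n := ⌊f a / T⌋
  have hmem : ∀ t, f t ∈ Ioo (n * T) ((n + 1) * T) := by
    have hpre : IsPreconnected (range f) := isPreconnected_range hf
    have ha1 : n * T ≤ f a := (le_div_iff₀ hT).1 (Int.floor_le _)
    have ha2 : f a ≤ (n + 1) * T := ((div_lt_iff₀ hT).1 (Int.lt_floor_add_one _)).le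
    intro t
    constructor
    · by_contra! hc
      obtain ⟨s, hs⟩ := hpre.Icc_subset (mem_range_self t) (mem_range_self a) ⟨hc, ha1⟩
      exact h s n hs
    · by_contra! hc
      obtain ⟨s, hs⟩ := hpre.Icc_subset (mem_range_self a) (mem_range_self t) ⟨ha2, hc⟩
      exact h s (n + 1) (by push_cast; exact hs)
  have h1 := hmem a
  have h2 := hmem b
  rw [abs_lt]
  constructor <;> linarith [h1.1, h1.2, h2.1, h2.2]

/-- A curve `c` on the unit circle whose velocity is `h(t) F(c)` is a reparametrization `φ ∘ τ` of
`φ`. If `c` is antiperiodic with the half period of `φ` and never parallel to `φ`, then `τ` advances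
by exactly one half period per half period: it cannot overtake `φ` or fall behind. -/
lemma IsCircleFlow.exists_lift {F : X → X} {φ : ℝ → X} (hφ : IsCircleFlow ω F φ) (halt : ω.IsAlt)
    {T : ℝ} (hT : IsHalfPeriod ω φ T) {c : ℝ → X} {h : ℝ → ℝ} (hh : Continuous h)
    (hc : ∀ t, HasDerivAt c (h t • F (c t)) t) (hcS : ∀ t, ‖c t‖ = 1)
    (hcT : Function.Antiperiodic c T) (hne : ∀ t, ω (c t) (φ t) ≠ 0) :
    ∃ τ : ℝ → ℝ, (∀ t, HasDerivAt τ (h t) t) ∧ (∀ t, c t = φ (τ t)) ∧ ∀ t, τ (t + T) = τ t + T := by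
  obtain ⟨τ₀, hτ₀⟩ : c 0 ∈ range φ := by rw [hφ.range_eq]; exact hcS 0
  let τ : ℝ → ℝ := fun t => τ₀ + ∫ s in (0 : ℝ)..t, h s
  have hτ : ∀ t, HasDerivAt τ (h t) t := fun t =>
    (intervalIntegral.integral_hasDerivAt_right (hh.intervalIntegrable _ _)
      (hh.stronglyMeasurableAtFilter _ _) hh.continuousAt).const_add τ₀
  have hcτ : ∀ t, φ (τ t) = c t := by
    refine congrFun (eq_of_hasDerivAt_smul (f := fun t => φ (τ t)) hφ.contDiffAt hh
      (fun t => (hφ.hasDerivAt (τ t)).scomp t (hτ t)) hc (fun t => hφ.ne_zero _) (a := 0) ?_)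
    simpa [τ] using hτ₀
  have hτc : Continuous τ := continuous_iff_continuousAt.2 fun t => (hτ t).continuousAt
  have hint : ∀ (n : ℤ) (t : ℝ), ω (φ t) (φ (t + n * T)) = 0 := by
    intro n t
    rcases Int.even_or_odd' n with ⟨m, rfl | rfl⟩
    · have := hT.antiperiodic.periodic_two_mul.int_mul m t
      rw [show t + ((2 * m : ℤ) : ℝ) * T = t + m * (2 * T) by push_cast; ring, this]
      exact halt _
    · have := hT.antiperiodic.periodic_two_mul.int_mul m (t + T)
      rw [show t + ((2 * m + 1 : ℤ) : ℝ) * T = t + T + m * (2 * T) by push_cast; ring, this,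
        hT.antiperiodic, map_neg, halt, neg_zero]
  refine ⟨τ, hτ, fun t => (hcτ t).symm, fun t => ?_⟩
  have hosc := abs_sub_lt_of_forall_ne_int_mul (f := fun t => t - τ t)
    (continuous_id.sub hτc) hT.pos (fun t n hn => hne t (by
      have h1 := hint n (τ t)
      rw [show τ t + n * T = t by linarith, hcτ] at h1
      exact h1)) t (t + T)
  rw [abs_lt] at hosc
  have hanti : φ (τ (t + T)) = -φ (τ t) := by rw [hcτ, hcτ, hcT]
  -- `δ` is the advance of `τ` minus one half period
  set δ := τ (t + T) - τ t - T with hδ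
  have h2 : φ (τ t + δ) = φ (τ t) := by
    have h3 := hT.antiperiodic (τ t + δ)
    rw [show τ t + δ + T = τ (t + T) by rw [hδ]; ring, hanti] at h3
    exact (neg_injective h3).symm
  have hδ0 : δ = 0 := by
    rcases lt_trichotomy δ 0 with h3 | h3 | h3
    · have h4 := hT.form_pos (τ t + δ) (-δ) (by linarith) (by linarith)
      rw [h2, add_neg_cancel_right, halt] at h4
      exact absurd h4 (lt_irrefl _)
    · exact h3
    · have h4 := hT.form_pos (τ t) δ h3 (by linarith)
      rw [h2, halt] at h4
      exact absurd h4 (lt_irrefl _)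
  linarith

lemma integral_comp_lift {T : ℝ} {τ h G : ℝ → ℝ} (hh : Continuous h)
    (hτ : ∀ t, HasDerivAt τ (h t) t) (hτT : ∀ t, τ (t + T) = τ t + T) (hG : Continuous G)
    (hGT : Function.Periodic G T) (a : ℝ) :
    ∫ t in a..a + T, G (τ t) * h t = ∫ t in a..a + T, G t := by
  have h1 := intervalIntegral.integral_comp_mul_deriv (a := a) (b := a + T) (fun t _ => hτ t)
    hh.continuousOn hG
  rw [hτT, hGT.intervalIntegral_add_eq (τ a) a] at h1
  exact h1

end Lift

/-! ### Integrating the velocity of a closed curve -/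

section Closing

variable {ω : LinearMap.BilinForm ℝ X}

lemma hasDerivWithinAt_Ici_of_Icc {E : Type*} [NormedAddCommGroup E] [NormedSpace ℝ E]
    {f : ℝ → E} {f' : E} {l s : ℝ} (hs : s ∈ Ico 0 l) (h : HasDerivWithinAt f f' (Icc 0 l) s) :
    HasDerivWithinAt f f' (Ici s) s :=
  h.mono_of_mem_nhdsWithin (Icc_mem_nhdsGE_of_mem hs)

/-- Let `γ : [0, l] → X` be a closed curve onto a bounded symmetric set `B`, whose velocity is
`c (u s)` with `u' = k` constant. Then `γ`, reparametrized by `u`, extends to an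
antiperiodic curve on the whole line which stays in `B` and has velocity `c / k`. The sign of
`[ψ, c]` is that of `k`, since `ψ` moves from `ψ t` to `-ψ t` while `c` stays on the positive side
of `c t`. -/
lemma exists_antiperiodic_extension [FiniteDimensional ℝ X] (halt : ω.IsAlt) {c : ℝ → X}
    (hc : Continuous c) {T : ℝ}
    (hT : IsHalfPeriod ω c T) {B : Set X} (hB0 : (0 : X) ∉ B) (hBne : B.Nonempty)
    (hBneg : ∀ x ∈ B, -x ∈ B) (hBb : Bornology.IsBounded B) {γ : ℝ → X} {u : ℝ → ℝ} {l k : ℝ}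
    (himage : γ '' Icc 0 l = B) (hclosed : γ 0 = γ l)
    (hγ : ∀ s ∈ Icc 0 l, HasDerivWithinAt γ (c (u s)) (Icc 0 l) s)
    (hu : ∀ s ∈ Icc 0 l, HasDerivWithinAt u k (Icc 0 l) s) :
    k ≠ 0 ∧ ∃ ψ : ℝ → X, (∀ t, HasDerivAt ψ (k⁻¹ • c t) t) ∧ (∀ t, ψ t ∈ B) ∧
      Function.Antiperiodic ψ T ∧ ∀ t, 0 < k * ω (ψ t) (c t) := by
  have hTpos := hT.pos
  have hcne : ∀ t, c t ≠ 0 := by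
    intro t h
    have := hT.form_pos t (T / 2) (by linarith) (by linarith)
    simp [h] at this
  have hl : 0 < l := by
    by_contra! hl
    obtain ⟨x, hx⟩ := hBne
    have hsub : ∀ y ∈ B, y = γ 0 := by
      intro y hy
      rw [← himage] at hy
      obtain ⟨s, hs, rfl⟩ := hy
      rw [le_antisymm (hs.2.trans hl) hs.1]
    have h1 : x = -x := (hsub x hx).trans (hsub _ (hBneg x hx)).symm
    have h2 : (2 : ℝ) • x = 0 := by rw [two_smul, ← eq_neg_iff_add_eq_zero]; exact h1
    exact hB0 ((smul_eq_zero.1 h2).resolve_left two_ne_zero ▸ hx)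
  have h0mem : (0 : ℝ) ∈ Icc 0 l := ⟨le_rfl, hl.le⟩
  have hlmem : l ∈ Icc 0 l := ⟨hl.le, le_rfl⟩
  have hu_eq : ∀ s ∈ Icc 0 l, u s = u 0 + k * s := by
    refine eq_of_has_deriv_right_eq (f' := fun _ => k)
      (fun s hs => hasDerivWithinAt_Ici_of_Icc hs (hu s ⟨hs.1, hs.2.le⟩))
      (fun s _ => ?_) (fun s hs => (hu s hs).continuousWithinAt) (by fun_prop) (by simp)
    simpa using (((hasDerivAt_id s).const_mul k).const_add (u 0)).hasDerivWithinAt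
  have hk : k ≠ 0 := by
    rintro rfl
    have h1 : ∀ s ∈ Icc 0 l, γ s = γ 0 + s • c (u 0) := by
      refine eq_of_has_deriv_right_eq (f' := fun _ => c (u 0)) (fun s hs => ?_)
        (fun s _ => ?_) (fun s hs => (hγ s hs).continuousWithinAt) (by fun_prop) (by simp)
      · have := hasDerivWithinAt_Ici_of_Icc hs (hγ s ⟨hs.1, hs.2.le⟩)
        rwa [hu_eq s ⟨hs.1, hs.2.le⟩, zero_mul, add_zero] at this
      · simpa using (((hasDerivAt_id s).smul_const (c (u 0))).const_add (γ 0)).hasDerivWithinAt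
    have h2 := h1 l hlmem
    rw [← hclosed, left_eq_add] at h2
    exact (smul_ne_zero hl.ne' (hcne _)) h2
  let ψ : ℝ → X := fun t => γ 0 + k⁻¹ • ∫ s in (u 0)..t, c s
  have hψ : ∀ t, HasDerivAt ψ (k⁻¹ • c t) t := fun t =>
    ((intervalIntegral.integral_hasDerivAt_right (hc.intervalIntegrable _ _)
      (hc.stronglyMeasurableAtFilter _ _) hc.continuousAt).const_smul k⁻¹).const_add (γ 0)
  have hγψ : ∀ s ∈ Icc 0 l, γ s = ψ (u 0 + k * s) := by
    have hd : ∀ s, HasDerivAt (fun s => ψ (u 0 + k * s)) (c (u 0 + k * s)) s := by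
      intro s
      have h1 : HasDerivAt (fun s => u 0 + k * s) k s := by
        simpa using ((hasDerivAt_id s).const_mul k).const_add (u 0)
      have h2 := (hψ (u 0 + k * s)).scomp s h1
      rwa [smul_smul, mul_inv_cancel₀ hk, one_smul] at h2
    refine eq_of_has_deriv_right_eq (f' := fun s => c (u s))
      (fun s hs => hasDerivWithinAt_Ici_of_Icc hs (hγ s ⟨hs.1, hs.2.le⟩)) (fun s hs => ?_)
      (fun s hs => (hγ s hs).continuousWithinAt)
      (fun s _ => (hd s).continuousAt.continuousWithinAt) (by simp [ψ])
    rw [hu_eq s ⟨hs.1, hs.2.le⟩]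
    exact (hd s).hasDerivWithinAt
  -- `ψ t + ψ (t + T)` is a constant `E`, because `c` is antiperiodic
  obtain ⟨E, hE⟩ : ∃ E, ∀ t, ψ (t + T) = E - ψ t := by
    have hd : ∀ t, HasDerivAt (fun t => ψ (t + T) + ψ t) 0 t := by
      intro t
      have h1 := ((hψ (t + T)).comp_add_const t T).add (hψ t)
      rwa [hT.antiperiodic, smul_neg, neg_add_cancel] at h1
    refine ⟨ψ (0 + T) + ψ 0, fun t => ?_⟩
    rw [eq_sub_iff_add_eq]
    exact is_const_of_deriv_eq_zero (fun t => (hd t).differentiableAt) (fun t => (hd t).deriv) t 0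
  have hper : Function.Periodic ψ (2 * T) := by
    intro t
    rw [two_mul, ← add_assoc, hE, hE, sub_sub_cancel]
  -- on an interval of length `T` the curve `ψ` moves to one side
  have hmono : ∀ a b, a < b → b ≤ a + T → k * ω (c a) (ψ a) < k * ω (c a) (ψ b) := by
    intro a b hab hb
    have hd : ∀ t, HasDerivAt (fun t => k * ω (c a) (ψ t)) (ω (c a) (c t)) t := by
      intro t
      have h1 := (hasDerivAt_form (ω := ω) (hasDerivAt_const t (c a)) (hψ t)).const_mul k
      simpa [hk] using h1
    refine strictMonoOn_of_deriv_pos (convex_Icc a (a + T))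
      (fun t _ => (hd t).continuousAt.continuousWithinAt) (fun t ht => ?_)
      ⟨le_rfl, by linarith⟩ ⟨hab.le, hb⟩ hab
    rw [interior_Icc] at ht
    rw [(hd t).deriv]
    have := hT.form_pos a (t - a) (by linarith [ht.1]) (by linarith [ht.2])
    rwa [add_sub_cancel] at this
  have hlen : ∀ a b, a < b → ψ a = ψ b → 2 * T ≤ b - a := by
    intro a b hab h
    by_contra! hlt
    rcases le_total (b - a) T with h1 | h1
    · have := hmono a b hab (by linarith)
      rw [h] at this
      exact lt_irrefl _ this
    · have := hmono b (a + 2 * T) (by linarith) (by linarith)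
      rw [hper, h] at this
      exact lt_irrefl _ this
  have hψl : ψ (u 0) = ψ (u 0 + k * l) := by
    have h1 := hγψ 0 h0mem
    rw [mul_zero, add_zero] at h1
    rw [← h1, ← hγψ l hlmem, hclosed]
  have hmem : ∀ t, ψ t ∈ B := by
    intro t
    rw [← himage]
    rcases lt_or_gt_of_ne hk with hneg | hpos
    · have h1 := hlen (u 0 + k * l) (u 0) (by nlinarith) hψl.symm
      obtain ⟨y, hy, hty⟩ := hper.exists_mem_Ico (by linarith) t (u 0 + k * l)
      have h2 : (y - u 0) / k ∈ Icc 0 l :=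
        ⟨div_nonneg_of_nonpos (by linarith [hy.2]) hneg.le, by
          rw [div_le_iff_of_neg hneg]; linarith [hy.1]⟩
      refine ⟨(y - u 0) / k, h2, ?_⟩
      rw [hγψ _ h2, mul_div_cancel₀ _ hk, add_sub_cancel, hty]
    · have h1 := hlen (u 0) (u 0 + k * l) (by nlinarith) hψl
      obtain ⟨y, hy, hty⟩ := hper.exists_mem_Ico (by linarith) t (u 0)
      have h2 : (y - u 0) / k ∈ Icc 0 l :=
        ⟨div_nonneg (by linarith [hy.1]) hpos.le, by
          rw [div_le_iff₀ hpos]; linarith [hy.2]⟩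
      refine ⟨(y - u 0) / k, h2, ?_⟩
      rw [hγψ _ h2, mul_div_cancel₀ _ hk, add_sub_cancel, hty]
  -- `B` is symmetric about the origin and about `E / 2`, and bounded
  have hE0 : E = 0 := by
    have hstep : ∀ x ∈ B, x - E ∈ B := by
      intro x hx
      have h1 : ∃ t, ψ t = x := by
        rw [← himage] at hx
        obtain ⟨s, hs, rfl⟩ := hx
        exact ⟨_, (hγψ s hs).symm⟩
      obtain ⟨t, rfl⟩ := h1
      have h2 := hBneg _ (hmem (t + T))
      rwa [hE, neg_sub] at h2
    obtain ⟨x, hx⟩ := hBne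
    have hn : ∀ n : ℕ, x - (n : ℝ) • E ∈ B := by
      intro n
      induction n with
      | zero => simpa using hx
      | succ n ih =>
        rw [Nat.cast_succ, add_smul, one_smul, ← sub_sub]
        exact hstep _ ih
    obtain ⟨M, hM⟩ := hBb.exists_norm_le
    by_contra hE
    have hEpos : 0 < ‖E‖ := norm_pos_iff.2 hE
    obtain ⟨n, hn'⟩ := exists_nat_gt (2 * M / ‖E‖)
    rw [div_lt_iff₀ hEpos] at hn'
    have h1 : ‖(n : ℝ) • E‖ ≤ M + M := by
      have h2 : (n : ℝ) • E = x - (x - (n : ℝ) • E) := by abel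
      rw [h2]
      exact (norm_sub_le _ _).trans (add_le_add (hM _ hx) (hM _ (hn n)))
    rw [norm_smul, Real.norm_natCast] at h1
    linarith
  have hanti : Function.Antiperiodic ψ T := fun t => by rw [hE, hE0, zero_sub]
  refine ⟨hk, ψ, hψ, hmem, hanti, fun t => ?_⟩
  have h1 := hmono t (t + T) (by linarith) le_rfl
  rw [hanti, map_neg, form_swap halt (c t)] at h1
  linarith

end Closing

/-! ### A Wirtinger inequality for `y'' + ρ y` -/

section Wirtinger

/-- If `D` vanishes at a simple zero of `y`, then the function `D D' - D² y' / y` that appears in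
Picone's identity extends by `0` to that zero. With `x / 0 = 0` it takes this value there. -/
lemma continuousAt_picone {y y' D D' : ℝ → ℝ} (hy : ∀ t, HasDerivAt y (y' t) t)
    (hyc : Continuous y') (hD : ∀ t, HasDerivAt D (D' t) t) (hDc : Continuous D') {a : ℝ}
    (hya : y a = 0) (hya' : y' a ≠ 0) (hDa : D a = 0) :
    ContinuousAt (fun t => D t * (D' t - D t * y' t / y t)) a := by
  rw [continuousAt_iff_punctured_nhds, hDa, zero_mul]
  have h1 : Tendsto (fun t => D t / y t) (𝓝[≠] a) (𝓝 (D' a / y' a)) := by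
    refine ((hD a).tendsto_slope.div (hy a).tendsto_slope hya').congr' ?_
    filter_upwards [self_mem_nhdsWithin] with t ht
    have : t - a ≠ 0 := sub_ne_zero.2 ht
    simp only [Pi.div_apply, slope_def_field, hya, hDa, sub_zero]
    rw [div_div_div_cancel_right₀ this]
  have hDt : Tendsto D (𝓝[≠] a) (𝓝 0) := by
    have := (hD a).continuousAt.tendsto.mono_left (nhdsWithin_le_nhds (s := {a}ᶜ))
    rwa [hDa] at this
  have hyt : Tendsto y' (𝓝[≠] a) (𝓝 (y' a)) := hyc.continuousAt.mono_left nhdsWithin_le_nhds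
  have hD't : Tendsto D' (𝓝[≠] a) (𝓝 (D' a)) := hDc.continuousAt.mono_left nhdsWithin_le_nhds
  have h2 := hDt.mul (hD't.sub (h1.mul hyt))
  rw [zero_mul] at h2
  refine h2.congr fun t => ?_
  rw [div_mul_eq_mul_div]

/-- If `y'' + ρ y = 0` has a solution that is positive between two consecutive zeros `a < b`, then
the quadratic form `∫ D (D'' + ρ D)` is nonpositive on the functions that vanish at `a` and `b`.
By Picone's identity the integrand is `(D D' - D² y' / y)' - (D' - D y' / y)²`. -/
lemma integral_mul_nonpos {a b : ℝ} (hab : a ≤ b) {y y' D D' D'' ρ : ℝ → ℝ}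
    (hy : ∀ t, HasDerivAt y (y' t) t) (hy' : ∀ t, HasDerivAt y' (-(ρ t * y t)) t)
    (hpos : ∀ t ∈ Ioo a b, 0 < y t) (hya : y a = 0) (hyb : y b = 0) (hya' : y' a ≠ 0)
    (hyb' : y' b ≠ 0) (hD : ∀ t, HasDerivAt D (D' t) t) (hD' : ∀ t, HasDerivAt D' (D'' t) t)
    (hDa : D a = 0) (hDb : D b = 0) (hρ : Continuous ρ) (hD'' : Continuous D'') :
    ∫ t in a..b, D t * (D'' t + ρ t * D t) ≤ 0 := by
  have hyc : Continuous y' := continuous_iff_continuousAt.2 fun t => (hy' t).continuousAt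
  have hDc : Continuous D := continuous_iff_continuousAt.2 fun t => (hD t).continuousAt
  have hDc' : Continuous D' := continuous_iff_continuousAt.2 fun t => (hD' t).continuousAt
  have hfc : Continuous fun t => D t * (D'' t + ρ t * D t) := by fun_prop
  let P : ℝ → ℝ := fun t => D t * (D' t - D t * y' t / y t)
  let I : ℝ → ℝ := fun t => ∫ s in a..t, D s * (D'' s + ρ s * D s)
  have hI : ∀ t, HasDerivAt I (D t * (D'' t + ρ t * D t)) t := fun t =>
    intervalIntegral.integral_hasDerivAt_right (hfc.intervalIntegrable _ _)
      (hfc.stronglyMeasurableAtFilter _ _) hfc.continuousAt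
  have hP : ∀ t ∈ Ioo a b,
      HasDerivAt P (D t * (D'' t + ρ t * D t) + (D' t - D t * y' t / y t) ^ 2) t := by
    intro t ht
    have h0 := (hpos t ht).ne'
    refine ((hD t).mul ((hD' t).sub (((hD t).mul (hy' t)).div (hy t) h0))).congr_deriv ?_
    simp only [Pi.mul_apply, Pi.sub_apply, Pi.div_apply]
    field_simp
    ring
  have hPc : ContinuousOn P (Icc a b) := by
    intro t ht
    rcases eq_endpoints_or_mem_Ioo_of_mem_Icc ht with rfl | rfl | h
    · exact (continuousAt_picone hy hyc hD hDc' hya hya' hDa).continuousWithinAt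
    · exact (continuousAt_picone hy hyc hD hDc' hyb hyb' hDb).continuousWithinAt
    · exact (hP t h).continuousAt.continuousWithinAt
  have hmono : MonotoneOn (fun t => P t - I t) (Icc a b) := by
    have hd : ∀ t ∈ Ioo a b, HasDerivAt (fun t => P t - I t) ((D' t - D t * y' t / y t) ^ 2) t :=
      fun t ht => ((hP t ht).sub (hI t)).congr_deriv (by ring)
    refine monotoneOn_of_deriv_nonneg (convex_Icc a b)
      (hPc.sub fun t _ => (hI t).continuousAt.continuousWithinAt) ?_ ?_
    · rw [interior_Icc]
      exact fun t ht => (hd t ht).differentiableAt.differentiableWithinAt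
    · rw [interior_Icc]
      intro t ht
      rw [(hd t ht).deriv]
      positivity
  have h := hmono ⟨le_rfl, hab⟩ ⟨hab, le_rfl⟩ hab
  simp only [P, I, hDa, hDb, zero_mul, intervalIntegral.integral_same, sub_zero] at h
  linarith

lemma eq_zero_of_integral_nonpos {T : ℝ} (hT : 0 < T) {f : ℝ → ℝ} (hf : Continuous f)
    (hfT : Function.Periodic f T) (hnn : ∀ t, 0 ≤ f t) {a : ℝ}
    (hint : ∫ t in a..a + T, f t ≤ 0) (t : ℝ) : f t = 0 := by
  rw [hfT.intervalIntegral_add_eq a t] at hint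
  by_contra hne
  have hpos := lt_of_le_of_ne (hnn t) (Ne.symm hne)
  have := intervalIntegral.integral_pos (a := t) (b := t + T) (by linarith) hf.continuousOn
    (fun x _ => hnn x) ⟨t, ⟨le_rfl, by linarith⟩, hpos⟩
  linarith

variable {ω : LinearMap.BilinForm ℝ X}

/-- The Wirtinger inequality for a plane curve `c` with `c'' = -ρ c` and half period `T`: the
coordinate `[c a, c t]` is a solution of `y'' + ρ y = 0` that is positive on `(a, a + T)`. -/
lemma IsHalfPeriod.integral_mul_nonpos [FiniteDimensional ℝ X] (halt : ω.IsAlt)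
    {c c' : ℝ → X} {T : ℝ} (hT : IsHalfPeriod ω c T) {ρ : ℝ → ℝ} (hρ : Continuous ρ)
    (hc : ∀ t, HasDerivAt c (c' t) t) (hc' : ∀ t, HasDerivAt c' (-ρ t • c t) t)
    (hne : ∀ t, ω (c t) (c' t) ≠ 0) {D D' D'' : ℝ → ℝ} (hD : ∀ t, HasDerivAt D (D' t) t)
    (hD' : ∀ t, HasDerivAt D' (D'' t) t) (hD'' : Continuous D'') {a : ℝ} (hDa : D a = 0)
    (hDb : D (a + T) = 0) : ∫ t in a..a + T, D t * (D'' t + ρ t * D t) ≤ 0 := by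
  have hcT : c a = -c (a + T) := by rw [hT.antiperiodic, neg_neg]
  refine NormedPlane.integral_mul_nonpos (by linarith [hT.pos]) (y := fun t => ω (c a) (c t))
    (y' := fun t => ω (c a) (c' t)) (fun t => ?_) (fun t => ?_) (fun t ht => ?_) (halt _) ?_
    (hne a) ?_ hD hD' hDa hDb hρ hD''
  · simpa using hasDerivAt_form (ω := ω) (hasDerivAt_const t (c a)) (hc t)
  · simpa using hasDerivAt_form (ω := ω) (hasDerivAt_const t (c a)) (hc' t)
  · have := hT.form_pos a (t - a) (by linarith [ht.1]) (by linarith [ht.2])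
    rwa [add_sub_cancel] at this
  · rw [hT.antiperiodic, map_neg, halt, neg_zero]
  · rw [hcT, map_neg, LinearMap.neg_apply, neg_ne_zero]
    exact hne _

end Wirtinger

/-! ### Harmonic motion along the unit circle -/

section Harmonic

/-- If the unit circle is traced by a solution of `φ'' = -κ² φ`, then it is the ellipse
`cos (κ t) p + sin (κ t) q / κ` and the plane is Euclidean. -/
lemma isEuclidean_of_harmonic (hdim : Module.finrank ℝ X = 2) {κ : ℝ} (hκ : 0 < κ)
    {φ χ : ℝ → X} (hφ : ∀ t, HasDerivAt φ (χ t) t) (hχ : ∀ t, HasDerivAt χ (-(κ ^ 2) • φ t) t)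
    (hS : ∀ t, ‖φ t‖ = 1) : IsEuclidean X := by
  have hs : ∀ t, HasDerivAt (fun t => Real.sin (κ * t)) (κ * Real.cos (κ * t)) t := fun t => by
    simpa [mul_comm] using ((hasDerivAt_id t).const_mul κ).sin
  have hc : ∀ t, HasDerivAt (fun t => Real.cos (κ * t)) (-(κ * Real.sin (κ * t))) t := fun t => by
    simpa [mul_comm] using ((hasDerivAt_id t).const_mul κ).cos
  -- two first integrals of the equation
  have hA : ∀ t, Real.cos (κ * t) • φ t - (κ⁻¹ * Real.sin (κ * t)) • χ t = φ 0 := by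
    intro t
    have hd : ∀ t, HasDerivAt
        (fun t => Real.cos (κ * t) • φ t - (κ⁻¹ * Real.sin (κ * t)) • χ t) 0 t := by
      intro t
      refine (((hc t).smul (hφ t)).sub (((hs t).const_mul κ⁻¹).smul (hχ t))).congr_deriv ?_
      match_scalars <;> field_simp <;> ring
    have := is_const_of_deriv_eq_zero (fun t => (hd t).differentiableAt) (fun t => (hd t).deriv) t 0
    simpa using this
  have hB : ∀ t, (κ * Real.sin (κ * t)) • φ t + Real.cos (κ * t) • χ t = χ 0 := by
    intro t
    have hd : ∀ t, HasDerivAt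
        (fun t => (κ * Real.sin (κ * t)) • φ t + Real.cos (κ * t) • χ t) 0 t := by
      intro t
      refine ((((hs t).const_mul κ).smul (hφ t)).add ((hc t).smul (hχ t))).congr_deriv ?_
      match_scalars <;> field_simp <;> ring
    have := is_const_of_deriv_eq_zero (fun t => (hd t).differentiableAt) (fun t => (hd t).deriv) t 0
    simpa using this
  have hsol : ∀ t, Real.cos (κ * t) • φ 0 + Real.sin (κ * t) • κ⁻¹ • χ 0 = φ t := by
    intro t
    rw [← hA t, ← hB t]
    have := Real.sin_sq_add_cos_sq (κ * t)
    match_scalars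
    · field_simp; linarith
    · ring
  have hnorm : ∀ x y : ℝ, ‖x • φ 0 + y • κ⁻¹ • χ 0‖ = √(x ^ 2 + y ^ 2) := by
    intro x y
    -- polar coordinates
    let z : ℂ := ⟨x, y⟩
    have h1 : x = ‖z‖ * Real.cos z.arg := (Complex.norm_mul_cos_arg z).symm
    have h2 : y = ‖z‖ * Real.sin z.arg := (Complex.norm_mul_sin_arg z).symm
    have h3 : √(x ^ 2 + y ^ 2) = ‖z‖ := by rw [Complex.norm_eq_sqrt_sq_add_sq]
    have h4 := hsol (κ⁻¹ * z.arg)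
    rw [mul_inv_cancel_left₀ hκ.ne'] at h4
    rw [h3, h1, h2, mul_smul, mul_smul, ← smul_add, h4, norm_smul, hS, mul_one, norm_norm]
  let L : EuclideanSpace ℝ (Fin 2) →ₗᵢ[ℝ] X :=
    { toFun := fun v => v 0 • φ 0 + v 1 • κ⁻¹ • χ 0
      map_add' := fun v v' => by simp only [PiLp.add_apply]; module
      map_smul' := fun r v => by
        simp only [PiLp.smul_apply, smul_eq_mul, RingHom.id_apply]; module
      norm_map' := fun v => by
        refine (hnorm (v 0) (v 1)).trans ?_
        rw [EuclideanSpace.norm_eq, Fin.sum_univ_two, Real.norm_eq_abs, Real.norm_eq_abs, sq_abs,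
          sq_abs] }
  have : FiniteDimensional ℝ X := FiniteDimensional.of_finrank_pos (by omega)
  exact ⟨(L.toLinearIsometryEquiv (by rw [finrank_euclideanSpace_fin, hdim])).symm⟩

end Harmonic

/-! ### The two parametrizations of the unit circle -/

section Parametrizations

variable {ω : LinearMap.BilinForm ℝ X} {w : X → X}

lemma IsAreaParametrization.form_deriv [FiniteDimensional ℝ X] {φ : ℝ → X}
    (hφ : IsAreaParametrization ω φ) (t : ℝ) :
    ω (φ t) (deriv φ t) = 1 := by
  have hc : Continuous fun t => ω (φ t) (deriv φ t) :=
    continuous_form hφ.contDiff.continuous (hφ.contDiff.continuous_deriv le_rfl)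
  have h1 : HasDerivAt (fun b => ∫ t in (0 : ℝ)..b, ω (φ t) (deriv φ t)) (ω (φ t) (deriv φ t)) t :=
    intervalIntegral.integral_hasDerivAt_right (hc.intervalIntegrable _ _)
      (hc.stronglyMeasurableAtFilter _ _) hc.continuousAt
  simp only [hφ.sector_area] at h1
  exact h1.unique ((hasDerivAt_id t).sub_const 0)

lemma IsAreaParametrization.isCircleFlow [FiniteDimensional ℝ X] (hw : IsTangentField ω w)
    (hdim : Module.finrank ℝ X = 2) (halt : ω.IsAlt) {φ : ℝ → X}
    (hφ : IsAreaParametrization ω φ) : IsCircleFlow ω w φ := by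
  have hS : ∀ t, ‖φ t‖ = 1 := fun t => by
    have : φ t ∈ unitCircle X := hφ.range_eq ▸ mem_range_self t
    exact this
  have hd : ∀ t, HasDerivAt φ (deriv φ t) t := fun t =>
    (hφ.contDiff.differentiable (by norm_num) t).hasDerivAt
  have hv : ∀ t, deriv φ t = w (φ t) := fun t => by
    have := hw.velocity_eq hdim halt hS (hd t)
    rwa [hφ.form_deriv, one_smul] at this
  exact ⟨hw.contDiffAt, hw.neg, fun t => hv t ▸ hd t, hφ.range_eq,
    fun t => by rw [← hv, hφ.form_deriv]; norm_num⟩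

lemma norm_deriv_eq_one_of_hasUnitSpeedOn {f : ℝ → X} (hf : ContDiff ℝ 1 f)
    (hu : HasUnitSpeedOn f univ) (t : ℝ) : ‖deriv f t‖ = 1 := by
  have hvar : ∀ a b, eVariationOn f (Icc a b) = ENNReal.ofReal (b - a) := by
    intro a b
    have := hu (mem_univ a) (mem_univ b)
    rwa [univ_inter, NNReal.coe_one, one_mul] at this
  refine le_antisymm ?_ ?_
  · have hlip : LipschitzWith 1 f := by
      refine LipschitzWith.of_dist_le_mul fun a b => ?_
      rw [NNReal.coe_one, one_mul]
      wlog hab : a ≤ b generalizing a b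
      · rw [dist_comm, dist_comm a]; exact this b a (le_of_not_ge hab)
      have h1 := eVariationOn.edist_le f (left_mem_Icc.2 hab) (right_mem_Icc.2 hab)
      rw [hvar, edist_dist, ENNReal.ofReal_le_ofReal_iff (by linarith)] at h1
      rwa [dist_comm a, Real.dist_eq, abs_of_nonneg (by linarith)]
    simpa using norm_deriv_le_of_lipschitz hlip (x₀ := t)
  · by_contra! hlt
    obtain ⟨C, hC1, hC2⟩ := exists_between (show ‖deriv f t‖₊ < 1 from hlt)
    have hev : ∀ᶠ s in 𝓝 t, ‖deriv f s‖₊ < C :=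
      (hf.continuous_deriv le_rfl).nnnorm.continuousAt.eventually_lt_const hC1
    obtain ⟨ε, hε, hball⟩ := Metric.nhds_basis_closedBall.eventually_iff.1 hev
    rw [Real.closedBall_eq_Icc] at hball
    have hl : LipschitzOnWith C f (Icc (t - ε) (t + ε)) :=
      (convex_Icc _ _).lipschitzOnWith_of_nnnorm_deriv_le
        (fun s _ => hf.differentiable (by norm_num) s) fun s hs => (hball hs).le
    have h1 := hl.comp_eVariationOn_le (g := id) (s := Icc (t - ε) (t + ε)) fun s hs => hs
    rw [Function.comp_id, hvar, eVariationOn_id_Icc] at h1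
    have h2 : ENNReal.ofReal (t + ε - (t - ε)) ≠ 0 := by
      rw [Ne, ENNReal.ofReal_eq_zero]; linarith
    have h3 : (C : ENNReal) * ENNReal.ofReal (t + ε - (t - ε)) <
        1 * ENNReal.ofReal (t + ε - (t - ε)) :=
      ENNReal.mul_lt_mul_left h2 ENNReal.ofReal_ne_top (by exact_mod_cast hC2)
    rw [one_mul] at h3
    exact absurd h1 (not_le.2 h3)

lemma IsArcLengthParametrization.isCircleFlow (hw : IsTangentField ω w)
    (hdim : Module.finrank ℝ X = 2) (halt : ω.IsAlt) {σ : ℝ → X}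
    (hσ : IsArcLengthParametrization ω σ) :
    IsCircleFlow ω (fun x => ‖w x‖⁻¹ • w x) σ := by
  have hS : ∀ t, ‖σ t‖ = 1 := fun t => by
    have : σ t ∈ unitCircle X := hσ.range_eq ▸ mem_range_self t
    exact this
  have hd : ∀ t, HasDerivAt σ (deriv σ t) t := fun t =>
    (hσ.contDiff.differentiable (by norm_num) t).hasDerivAt
  have hv : ∀ t, deriv σ t = ‖w (σ t)‖⁻¹ • w (σ t) := fun t => by
    have h1 := hw.velocity_eq hdim halt hS (hd t)
    have h2 := norm_deriv_eq_one_of_hasUnitSpeedOn hσ.contDiff hσ.unitSpeed t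
    rw [h1, norm_smul, Real.norm_eq_abs, abs_of_pos (hσ.positive t)] at h2
    rw [← eq_inv_of_mul_eq_one_left h2]
    exact h1
  refine ⟨fun x hx => ?_, fun x => ?_, fun t => hv t ▸ hd t, hσ.range_eq,
    fun t => by rw [← hv]; exact hσ.positive t⟩
  · have h0 := hw.ne_zero hx
    have hn : ContDiffAt ℝ 1 (fun x => ‖w x‖) x :=
      ((hw.contDiffAt_norm _ h0).of_le (by norm_num)).comp x (hw.contDiffAt x hx)
    exact (hn.inv (norm_ne_zero_iff.2 h0)).smul (hw.contDiffAt x hx)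
  · rw [hw.neg, norm_neg, smul_neg]

end Parametrizations

/-! ### Circles of constant Minkowski curvature -/

section Minkowski

variable {ω : LinearMap.BilinForm ℝ X} {w : X → X} [FiniteDimensional ℝ X]

/-- The plane is Euclidean if the area parametrization `φ` of its unit circle has an antiderivative
that, up to the factor `k`, stays on the unit circle. The function `H = [ψ, φ]` satisfies
`H'' + ρ H = 1 / k`, where `φ'' = -ρ φ`; it turns out to be constant. -/
lemma isEuclidean_of_mem_unitCircle (hw : IsTangentField ω w) (hdim : Module.finrank ℝ X = 2)
    (halt : ω.IsAlt) {φ ψ : ℝ → X} (hφ : IsCircleFlow ω w φ) {T : ℝ} (hT : IsHalfPeriod ω φ T)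
    {k : ℝ} (hk : 0 < k) (hψ : ∀ t, HasDerivAt ψ (k⁻¹ • φ t) t) (hψS : ∀ t, ‖ψ t‖ = 1)
    (hψT : Function.Antiperiodic ψ T) (hpos : ∀ t, 0 < ω (ψ t) (φ t)) : IsEuclidean X := by
  have hφw : ∀ t, ω (φ t) (w (φ t)) = 1 := fun t => by
    rw [hw.form_self (hφ.ne_zero t), hφ.norm_eq_one]
  have hψ0 : ∀ t, ψ t ≠ 0 := fun t h => by have := hψS t; simp [h] at this
  have hψw : ∀ t, ω (ψ t) (w (ψ t)) = 1 := fun t => by rw [hw.form_self (hψ0 t), hψS]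
  let H : ℝ → ℝ := fun t => ω (ψ t) (φ t)
  have hH0 : ∀ t, H t ≠ 0 := fun t => (hpos t).ne'
  let ρ : X → ℝ := fun x => ω (w x) (fderiv ℝ w x (w x))
  have hφc := hφ.continuous
  have hψc : Continuous ψ := continuous_iff_continuousAt.2 fun t => (hψ t).continuousAt
  have hwφc : Continuous fun t => w (φ t) := continuous_iff_continuousAt.2 fun t =>
    (hw.hasDerivAt_comp (hφ.hasDerivAt t) (hφ.ne_zero t)).continuousAt
  have hHc : Continuous H := continuous_form hψc hφc
  have hρc : Continuous fun t => ρ (φ t) := by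
    refine continuous_form hwφc (Continuous.clm_apply ?_ hwφc)
    refine continuous_iff_continuousAt.2 fun t => ?_
    have h1 : ContinuousAt (fderiv ℝ w) (φ t) :=
      ((hw.contDiffAt _ (hφ.ne_zero t)).fderiv_right (m := 0) (by norm_num)).continuousAt
    exact ContinuousAt.comp (f := φ) h1 hφc.continuousAt
  have hφ2 : ∀ t, HasDerivAt (fun t => w (φ t)) (-ρ (φ t) • φ t) t := fun t => by
    rw [← hw.fderiv_eq hdim halt (hφ.norm_eq_one t)]
    exact hw.hasDerivAt_comp (hφ.hasDerivAt t) (hφ.ne_zero t)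
  have hH1 : ∀ t, HasDerivAt H (ω (ψ t) (w (φ t))) t := fun t => by
    refine (hasDerivAt_form (hψ t) (hφ.hasDerivAt t)).congr_deriv ?_
    rw [map_smul, LinearMap.smul_apply, halt, smul_zero, zero_add]
  have hH2 : ∀ t, HasDerivAt (fun t => ω (ψ t) (w (φ t))) (k⁻¹ - ρ (φ t) * H t) t := fun t => by
    refine (hasDerivAt_form (hψ t) (hφ2 t)).congr_deriv ?_
    rw [map_smul, LinearMap.smul_apply, hφw, map_smul, smul_eq_mul, smul_eq_mul, mul_one]
    ring
  -- both `ψ' = φ / k` and `w ψ` are tangent to the circle at `ψ`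
  have hφψ : ∀ t, φ t = H t • w (ψ t) := fun t => by
    have h1 := hw.velocity_eq hdim halt hψS (hψ t)
    rw [map_smul, smul_eq_mul, mul_smul] at h1
    exact smul_right_injective X (inv_ne_zero hk.ne') h1
  have hψ' : ∀ t, HasDerivAt ψ ((H t / k) • w (ψ t)) t := fun t => by
    refine (hψ t).congr_deriv ?_
    conv_lhs => rw [hφψ t]
    rw [smul_smul, div_eq_inv_mul]
  -- differentiating `φ = H w ψ` gives the curvature at `ψ`
  have hρψ : ∀ t, ρ (ψ t) = k / H t ^ 3 := fun t => by
    have h1 := (hH1 t).smul (hw.hasDerivAt_comp (hψ' t) (hψ0 t))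
    have h2 : HasDerivAt φ _ t := h1.congr_of_eventuallyEq (Eventually.of_forall hφψ)
    have h3 := (hφ.hasDerivAt t).unique h2
    have h4 := congrArg (ω (φ t)) h3
    rw [hφw, map_smul, hw.fderiv_eq hdim halt (hψS t)] at h4
    conv_rhs at h4 => rw [hφψ t]
    simp only [map_add, map_smul, map_neg, LinearMap.smul_apply, smul_eq_mul, neg_smul,
      halt (w (ψ t)), form_swap halt (w (ψ t)) (ψ t), hψw] at h4
    have h5 : 1 = H t ^ 3 / k * ρ (ψ t) := by
      rw [h4]
      ring
    have := hH0 t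
    field_simp at h5 ⊢
    linarith
  obtain ⟨τ, hτ, hψτ, hτT⟩ := hφ.exists_lift halt hT (h := fun t => H t / k) (by fun_prop) hψ' hψS
    hψT hH0
  have hHT : Function.Periodic H T := fun t => by
    simp only [H, hψT t, hT.antiperiodic t, map_neg, LinearMap.neg_apply, neg_neg]
  have hHpos : ∀ t, 0 < H t := hpos
  clear_value ρ H
  obtain ⟨r, hr⟩ : ∃ r : ℝ → ℝ, ∀ t, r t = ρ (φ t) := ⟨_, fun _ => rfl⟩
  simp only [← hr] at hρc hφ2 hH2
  have hrc : Continuous r := hρc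
  have hrT : Function.Periodic r T := fun t => by
    have h1 := ((hφ2 (t + T)).comp_add_const t T).unique
      ((hφ2 t).neg.congr_of_eventuallyEq (Eventually.of_forall fun s => by
        simp only [Pi.neg_apply, hT.antiperiodic s, hw.neg]))
    rw [hT.antiperiodic t, smul_neg, neg_inj] at h1
    rw [← neg_inj]
    exact smul_left_injective ℝ (hφ.ne_zero t) h1
  -- the mean value of `H` is `k`
  obtain ⟨a, ha⟩ : ∃ a, H a = k := by
    obtain ⟨a, -, ha⟩ := exists_hasDerivAt_eq_slope τ (fun t => H t / k) hT.pos
      (fun t _ => (hτ t).continuousAt.continuousWithinAt) fun t _ => hτ t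
    have h1 := hτT 0
    rw [zero_add] at h1
    rw [h1, add_sub_cancel_left, sub_zero, div_self hT.pos.ne'] at ha
    exact ⟨a, (div_eq_one_iff_eq hk.ne').1 ha⟩
  have hi1 : ∫ t in a..a + T, H t / k = ∫ t in a..a + T, (1 : ℝ) := by
    simpa using integral_comp_lift (h := fun t => H t / k) (by fun_prop) hτ hτT
      (continuous_const (y := (1 : ℝ))) (fun _ => rfl) a
  have hi2 : ∫ t in a..a + T, 1 / H t ^ 2 = ∫ t in a..a + T, r t := by
    rw [← integral_comp_lift (h := fun t => H t / k) (by fun_prop) hτ hτT hrc hrT a]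
    refine intervalIntegral.integral_congr fun t _ => ?_
    have := hH0 t
    simp only [hr, ← hψτ, hρψ]
    field_simp
  have hi3 : ∫ t in a..a + T, (k⁻¹ - r t * H t) = 0 := by
    rw [intervalIntegral.integral_eq_sub_of_hasDerivAt (fun t _ => hH2 t)
      (Continuous.intervalIntegrable (by fun_prop) _ _), hψT, hT.antiperiodic, hw.neg]
    simp
  have hW := hT.integral_mul_nonpos halt hrc hφ.hasDerivAt hφ2 (fun t => by rw [hφw]; norm_num)
    (D := fun t => H t - k) (fun t => (hH1 t).sub_const k) hH2 (by fun_prop) (a := a)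
    (by simp [ha]) (by simp [hHT a, ha])
  have hf : ∫ t in a..a + T, (H t - k) ^ 2 * (2 * H t + k) * (1 / H t ^ 2) / k ≤ 0 := by
    refine le_trans (le_of_eq ?_) hW
    have e : ∀ t, (H t - k) ^ 2 * (2 * H t + k) * (1 / H t ^ 2) / k =
        (H t - k) * (k⁻¹ - r t * H t + r t * (H t - k)) +
          (k ^ 2 * (1 / H t ^ 2 - r t) + (H t / k - 1) - k * (k⁻¹ - r t * H t)) := by
      intro t
      have := hH0 t
      field_simp
      ring
    have hz : ∫ t in a..a + T, (k ^ 2 * (1 / H t ^ 2 - r t) + (H t / k - 1) -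
        k * (k⁻¹ - r t * H t)) = 0 := by
      rw [intervalIntegral.integral_sub, intervalIntegral.integral_add,
        intervalIntegral.integral_const_mul, intervalIntegral.integral_const_mul,
        intervalIntegral.integral_sub, intervalIntegral.integral_sub, hi1, hi2, hi3]
      · ring
      all_goals exact Continuous.intervalIntegrable (by fun_prop (disch := simp [hH0])) _ _
    simp_rw [e]
    rw [intervalIntegral.integral_add, hz, add_zero]
    all_goals exact Continuous.intervalIntegrable (by fun_prop (disch := simp [hH0])) _ _
  have hHk : ∀ t, H t = k := fun t => by
    have h1 := eq_zero_of_integral_nonpos hT.pos (by fun_prop (disch := simp [hH0]))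
      (f := fun t => (H t - k) ^ 2 * (2 * H t + k) * (1 / H t ^ 2) / k)
      (fun t => by simp only [hHT t]) (fun t => by have := hHpos t; positivity) hf t
    have h2 := hHpos t
    have h3 : 2 * H t + k ≠ 0 := by positivity
    simp only [div_eq_zero_iff, mul_eq_zero, pow_eq_zero_iff, ne_eq, two_ne_zero,
      not_false_eq_true, one_ne_zero, h2.ne', hk.ne', h3, or_false] at h1
    linarith
  have hrk : ∀ t, r t = k⁻¹ ^ 2 := by
    have h1 : ∀ t, ω (ψ t) (w (φ t)) = 0 := fun t =>
      (hH1 t).unique ((hasDerivAt_const t k).congr_of_eventuallyEq (Eventually.of_forall hHk))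
    intro t
    have h2 := (hH2 t).unique
      ((hasDerivAt_const t (0 : ℝ)).congr_of_eventuallyEq (Eventually.of_forall h1))
    rw [hHk] at h2
    field_simp at h2 ⊢
    linarith
  exact isEuclidean_of_harmonic hdim (inv_pos.2 hk) hφ.hasDerivAt
    (fun t => hrk t ▸ hφ2 t) hφ.norm_eq_one

end Minkowski

/-! ### The unit anti-circle -/

section AntiCircle

variable {ω : LinearMap.BilinForm ℝ X} {w : X → X}

lemma neg_mem_unitAntiCircle {x : X} (hx : x ∈ unitAntiCircle ω) : -x ∈ unitAntiCircle ω := by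
  have h : antiNorm ω x = 1 := hx
  change antiNorm ω (-x) = 1
  rw [← h]
  simp only [antiNorm, map_neg, LinearMap.neg_apply, abs_neg]

lemma zero_notMem_unitAntiCircle : (0 : X) ∉ unitAntiCircle ω := by
  intro h
  have h1 : antiNorm ω (0 : X) = 1 := h
  have h2 : antiNorm ω (0 : X) ≤ 0 := by
    refine Real.sSup_nonpos ?_
    rintro _ ⟨y, -, rfl⟩
    simp
  linarith

lemma mem_unitAntiCircle (hw : IsTangentField ω w) (halt : ω.IsAlt) {x : X} (hx : ‖x‖ = 1) :
    w x ∈ unitAntiCircle ω := by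
  have h0 : x ≠ 0 := by rintro rfl; simp at hx
  have : Nontrivial X := ⟨x, 0, h0⟩
  have hG : IsGreatest ((fun y => |ω (w x) y|) '' unitCircle X) 1 := by
    refine ⟨⟨x, hx, ?_⟩, ?_⟩
    · change |ω (w x) x| = 1
      rw [form_swap halt, hw.form_self h0, hx, abs_neg, abs_one]
    · rintro _ ⟨y, hy, rfl⟩
      have hy' : ‖y‖ = 1 := hy
      change |ω (w x) y| ≤ 1
      rw [form_swap halt, abs_neg, hw.form_right, ← Real.norm_eq_abs]
      have h1 := (fderiv ℝ (fun y : X => ‖y‖) x).le_opNorm y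
      rwa [norm_fderiv_norm (hw.hasFDerivAt_norm h0).differentiableAt, hy', one_mul] at h1
  exact hG.csSup_eq

variable [FiniteDimensional ℝ X]

lemma isCompact_image_unitCircle (x : X) :
    IsCompact ((fun y => |ω x y|) '' unitCircle X) := by
  have : ProperSpace X := FiniteDimensional.proper_real X
  have h1 : unitCircle X = Metric.sphere (0 : X) 1 := by ext; simp [unitCircle]
  rw [h1]
  exact (isCompact_sphere _ _).image (ω x).continuous_of_finiteDimensional.abs

lemma abs_form_le {x : X} (hx : x ∈ unitAntiCircle ω) {y : X} (hy : ‖y‖ = 1) : |ω x y| ≤ 1 := by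
  have h : antiNorm ω x = 1 := hx
  rw [← h]
  exact le_csSup (isCompact_image_unitCircle x).bddAbove ⟨y, hy, rfl⟩

lemma exists_abs_form_eq_one {x : X} (hx : x ∈ unitAntiCircle ω) : ∃ y, ‖y‖ = 1 ∧ |ω x y| = 1 := by
  have h : antiNorm ω x = 1 := hx
  have hne : ((fun y => |ω x y|) '' unitCircle X).Nonempty := by
    by_contra hc
    rw [not_nonempty_iff_eq_empty] at hc
    rw [antiNorm, hc, Real.sSup_empty] at h
    norm_num at h
  obtain ⟨y, hy, hy'⟩ := (isCompact_image_unitCircle (ω := ω) x).sSup_mem hne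
  exact ⟨y, hy, hy'.trans h⟩

lemma isBounded_unitAntiCircle (hw : IsTangentField ω w) (hdim : Module.finrank ℝ X = 2)
    (halt : ω.IsAlt) : Bornology.IsBounded (unitAntiCircle ω) := by
  have : Nontrivial X := Module.nontrivial_of_finrank_pos (R := ℝ) (by omega)
  obtain ⟨a, ha⟩ := exists_norm_eq X zero_le_one
  have ha0 : a ≠ 0 := by rintro rfl; simp at ha
  have hb : ‖w a‖ ≠ 0 := norm_ne_zero_iff.2 (hw.ne_zero ha0)
  refine isBounded_iff_forall_norm_le.2 ⟨‖w a‖ + ‖w a‖, fun x hx => ?_⟩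
  have h1 : |ω x a| ≤ 1 := abs_form_le hx ha
  have h2 : |ω x (w a)| ≤ ‖w a‖ := by
    have h3 := abs_form_le hx (y := ‖w a‖⁻¹ • w a) (by
      rw [norm_smul, norm_inv, norm_norm, inv_mul_cancel₀ hb])
    rw [map_smul, smul_eq_mul, abs_mul, abs_inv, abs_norm, inv_mul_le_iff₀ (by positivity),
      mul_one] at h3
    exact h3
  have e := form_expansion hdim halt a (w a) x
  rw [hw.form_self ha0, ha, one_smul] at e
  rw [eq_neg_of_add_eq_zero_right e, norm_neg]
  refine (norm_add_le _ _).trans ?_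
  rw [norm_smul, norm_smul, ha, mul_one, Real.norm_eq_abs, Real.norm_eq_abs, form_swap halt,
    abs_neg]
  exact add_le_add h2 (mul_le_of_le_one_left (norm_nonneg _) h1)

/-- If a curve `ψ` on the anti-circle moves in the direction `σ` and `[ψ, σ] > 0`, then `-ψ` is the
image of `σ` under the tangent field: by the definition of the anti-norm, `[ψ s, σ t] ≤ 1` with
equality for `s = t`, and both partial derivatives vanish there. -/
lemma tangentField_eq_neg (hw : IsTangentField ω w) (hdim : Module.finrank ℝ X = 2)
    (halt : ω.IsAlt) (hnd : ω.Nondegenerate) {F : X → X} {σ ψ : ℝ → X} (hσ : IsCircleFlow ω F σ)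
    {k : ℝ} (hk : k ≠ 0) (hψ : ∀ t, HasDerivAt ψ (k⁻¹ • σ t) t)
    (hψS : ∀ t, ψ t ∈ unitAntiCircle ω) (hpos : ∀ t, 0 < ω (ψ t) (σ t)) (t : ℝ) :
    w (σ t) = -ψ t := by
  -- the supremum in the anti-norm of `ψ t` is attained at `σ t`
  have h1 : ω (ψ t) (σ t) = 1 := by
    obtain ⟨y, hy, hy1⟩ : ∃ y, ‖y‖ = 1 ∧ ω (ψ t) y = 1 := by
      obtain ⟨y, hy, hy1⟩ := exists_abs_form_eq_one (hψS t)
      rcases (abs_eq (by norm_num)).1 hy1 with h | h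
      · exact ⟨y, hy, h⟩
      · exact ⟨-y, by rwa [norm_neg], by rw [map_neg, h, neg_neg]⟩
    have hmax : IsLocalMax (fun s => ω (ψ s) y) t :=
      Eventually.of_forall fun s => by
        simp only [hy1]
        exact (le_abs_self _).trans (abs_form_le (hψS s) hy)
    have hd := hmax.hasDerivAt_eq_zero (hasDerivAt_form (hψ t) (hasDerivAt_const t y))
    rw [map_zero, add_zero, map_smul, LinearMap.smul_apply, smul_eq_zero] at hd
    rcases eq_or_eq_neg_of_form_eq_zero hdim halt hnd (hσ.norm_eq_one t) hy
      (hd.resolve_left (inv_ne_zero hk)) with h | h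
    · rw [h, hy1]
    · have := hpos t
      rw [h, map_neg, hy1] at this
      norm_num at this
  have h2 : ω (ψ t) (w (σ t)) = 0 := by
    have hmax : IsLocalMax (fun s => ω (ψ t) (σ s)) t :=
      Eventually.of_forall fun s => by
        simp only [h1]
        exact (le_abs_self _).trans (abs_form_le (hψS t) (hσ.norm_eq_one s))
    have hd := hmax.hasDerivAt_eq_zero
      (hasDerivAt_form (hasDerivAt_const t (ψ t)) (hσ.hasDerivAt t))
    rw [map_zero, LinearMap.zero_apply, zero_add,
      hw.velocity_eq hdim halt hσ.norm_eq_one (hσ.hasDerivAt t), map_smul, smul_eq_mul] at hd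
    exact (mul_eq_zero.1 hd).resolve_left (hσ.positive t).ne'
  have e := form_expansion hdim halt (σ t) (w (σ t)) (ψ t)
  rw [form_swap halt (w (σ t)), h2, h1, hw.form_self (hσ.ne_zero t), hσ.norm_eq_one, neg_zero,
    zero_smul, zero_add, one_smul, one_smul] at e
  exact eq_neg_of_add_eq_zero_left e

end AntiCircle

/-! ### Anti-circles of constant arc-length curvature -/

section ArcLength

variable {ω : LinearMap.BilinForm ℝ X} {w : X → X} [FiniteDimensional ℝ X]

/-- A continuous function with values among the roots of a quadratic polynomial is constant. -/
lemma eq_of_forall_quadratic_eq_zero {f : ℝ → ℝ} (hf : Continuous f) {p q r : ℝ} (hr : r ≠ 0)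
    (h : ∀ t, p + q * f t + r * f t ^ 2 = 0) (a b : ℝ) : f a = f b := by
  -- the midpoint of two values is again a value
  obtain ⟨c, hc⟩ : (f a + f b) / 2 ∈ range f := by
    have hpre := isPreconnected_range hf
    rcases le_total (f a) (f b) with hab | hab
    · exact hpre.Icc_subset (mem_range_self a) (mem_range_self b)
        ⟨by linarith, by linarith⟩
    · exact hpre.Icc_subset (mem_range_self b) (mem_range_self a)
        ⟨by linarith, by linarith⟩
  have h1 := h a
  have h2 := h b
  have h3 := h c
  rw [hc] at h3
  have h4 : r * (f a - f b) ^ 2 = 0 := by linarith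
  have h5 := (mul_eq_zero.1 h4).resolve_left hr
  linarith [pow_eq_zero_iff (two_ne_zero) |>.1 h5]

/-- The plane is Euclidean if the anti-circle `w ∘ σ`, where `σ` is the arc-length parametrization
of the unit circle, has velocity `-σ / k`. The function `R = ‖w ∘ σ‖` satisfies an equation
`R'' + R / (k R) = τ' / (k² R)`, where `τ` is the parameter of the tangent vector `σ'` on
the unit circle; it turns out to be constant. -/
lemma isEuclidean_of_hasDerivAt_tangentField (hw : IsTangentField ω w)
    (hdim : Module.finrank ℝ X = 2) (halt : ω.IsAlt) {σ : ℝ → X}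
    (hσ : IsCircleFlow ω (fun x => ‖w x‖⁻¹ • w x) σ) {T : ℝ} (hT : IsHalfPeriod ω σ T)
    {k : ℝ} (hk : 0 < k) (hη : ∀ t, HasDerivAt (fun t => w (σ t)) (-k⁻¹ • σ t) t) :
    IsEuclidean X := by
  have hTpos := hT.pos
  let η : ℝ → X := fun t => w (σ t)
  let R : ℝ → ℝ := fun t => ‖η t‖
  have hση : ∀ t, ω (σ t) (η t) = 1 := fun t =>
    (hw.form_self (hσ.ne_zero t)).trans (hσ.norm_eq_one t)
  have hησ : ∀ t, ω (η t) (σ t) = -1 := fun t => by rw [form_swap halt, hση]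
  have hη0 : ∀ t, η t ≠ 0 := fun t => hw.ne_zero (hσ.ne_zero t)
  have hRpos : ∀ t, 0 < R t := fun t => norm_pos_iff.2 (hη0 t)
  have hR0 : ∀ t, R t ≠ 0 := fun t => (hRpos t).ne'
  have hηT : Function.Antiperiodic η T := fun t => by simp only [η, hT.antiperiodic t, hw.neg]
  have hRT : Function.Periodic R T := fun t => by simp only [R, hηT t, norm_neg]
  have hηc : Continuous η := continuous_iff_continuousAt.2 fun t => (hη t).continuousAt
  have hRc : Continuous R := hηc.norm
  -- the unit tangent vector
  let P : ℝ → X := fun t => (R t)⁻¹ • η t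
  have hσ' : ∀ t, HasDerivAt σ (P t) t := hσ.hasDerivAt
  have hPS : ∀ t, ‖P t‖ = 1 := fun t => by
    simp only [P, norm_smul, norm_inv, Real.norm_eq_abs, abs_of_pos (hRpos t)]
    exact inv_mul_cancel₀ (hR0 t)
  have hP0 : ∀ t, P t ≠ 0 := fun t h => by have := hPS t; simp [h] at this
  have hPT : Function.Antiperiodic P T := fun t => by simp only [P, hRT t, hηT t, smul_neg]
  have hPc : Continuous P := (hRc.inv₀ hR0).smul hηc
  have hwη : ∀ t, w (η t) = w (P t) := fun t => (hw.smul_pos _ _ (inv_pos.2 (hRpos t))).symm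
  have hR1 : ∀ t, HasDerivAt R (-k⁻¹ * ω (σ t) (w (P t))) t := fun t => by
    refine (hw.hasDerivAt_norm (hη t) (hη0 t)).congr_deriv ?_
    rw [map_smul, LinearMap.smul_apply, smul_eq_mul]
    exact congrArg (fun x => -k⁻¹ * ω (σ t) x) (hwη t)
  have hwPc : Continuous fun t => w (P t) := continuous_iff_continuousAt.2 fun t =>
    ContinuousAt.comp (f := P) (hw.contDiffAt _ (hP0 t)).continuousAt hPc.continuousAt
  let h : ℝ → ℝ := fun t => k⁻¹ * (R t ^ 2)⁻¹ * ‖w (P t)‖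
  have hhc : Continuous h :=
    (continuous_const.mul ((hRc.pow 2).inv₀ fun t => pow_ne_zero 2 (hR0 t))).mul hwPc.norm
  have hP1 : ∀ t, HasDerivAt P (h t • ‖w (P t)‖⁻¹ • w (P t)) t := fun t => by
    have h1 : HasDerivAt P _ t := ((hR1 t).inv (hR0 t)).smul (hη t)
    have h2 := hw.velocity_eq hdim halt hPS h1
    rw [h2] at h1
    refine h1.congr_deriv ?_
    have h3 : ‖w (P t)‖ ≠ 0 := norm_ne_zero_iff.2 (hw.ne_zero (hP0 t))
    have h4 : ω (η t) (w (σ t)) = 0 := halt _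
    rw [smul_smul (h t)]
    congr 1
    rw [mul_inv_cancel_right₀ h3]
    conv_lhs => simp only [P]
    rw [map_smul, LinearMap.smul_apply, map_add, map_smul, map_smul, map_smul, hησ, h4,
      Pi.inv_apply]
    simp only [smul_eq_mul]
    have := hR0 t
    field_simp
    ring
  obtain ⟨τ, hτ, hPτ, hτT⟩ := hσ.exists_lift halt hT hhc hP1 hPS
    hPT
    (fun t => by
      simp only [P, map_smul, LinearMap.smul_apply, hησ, smul_eq_mul, mul_neg, mul_one]
      exact neg_ne_zero.2 (inv_ne_zero (hR0 t)))
  have hwP : ∀ t, w (P t) = η (τ t) := fun t => by simp only [η, hPτ]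
  have hh : ∀ t, h t = k⁻¹ * (R t ^ 2)⁻¹ * R (τ t) := fun t => by simp only [h, R, hwP]
  have hhpos : ∀ t, 0 < h t := fun t => by
    have := hRpos t; have := hRpos (τ t); rw [hh]; positivity
  have hR2 : ∀ t, HasDerivAt (fun t => -k⁻¹ * ω (σ t) (w (P t)))
      (-k⁻¹ + k⁻¹ ^ 2 * (h t * (R t)⁻¹)) t := fun t => by
    have h1 : HasDerivAt (fun t => w (P t)) (h t • -k⁻¹ • P t) t := by
      have h2 := (hη (τ t)).scomp t (hτ t)
      rw [← hPτ] at h2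
      exact h2.congr_of_eventuallyEq (Eventually.of_forall hwP)
    refine ((hasDerivAt_form (hσ' t) h1).const_mul (-k⁻¹)).congr_deriv ?_
    rw [hw.form_self (hP0 t), hPS]
    simp only [P, map_smul, smul_eq_mul, hση]
    ring
  have hη2 : ∀ t, HasDerivAt (fun t => -k⁻¹ • σ t) (-(k⁻¹ * (R t)⁻¹) • η t) t := fun t => by
    refine ((hσ' t).const_smul (-k⁻¹)).congr_deriv ?_
    simp only [P, smul_smul, neg_mul]
  -- `w ∘ σ` has the same half period as `σ`, because its direction is `σ ∘ τ`
  have hηhalf : IsHalfPeriod ω η T := by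
    refine ⟨hTpos, hηT, fun a t h0 h1 => ?_⟩
    have hmono : StrictMono τ := strictMono_of_hasDerivAt_pos hτ hhpos
    have h2 : τ a < τ (a + t) := hmono (by linarith)
    have h3 : τ (a + t) < τ a + T := by rw [← hτT]; exact hmono (by linarith)
    have h4 := hT.form_pos (τ a) (τ (a + t) - τ a) (by linarith) (by linarith)
    rw [add_sub_cancel, ← hPτ, ← hPτ] at h4
    simp only [P, map_smul, LinearMap.smul_apply, smul_eq_mul] at h4
    have h5 := inv_pos.2 (hRpos a)
    have h6 := inv_pos.2 (hRpos (a + t))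
    exact pos_of_mul_pos_right (pos_of_mul_pos_right h4 h6.le) h5.le
  clear_value R h
  have hRic : Continuous fun t => (R t)⁻¹ := hRc.inv₀ hR0
  let J : ℝ := ∫ t in (0 : ℝ)..0 + T, (R t)⁻¹
  have hJpos : 0 < J := intervalIntegral.integral_pos (by linarith) hRic.continuousOn
    (fun t _ => (inv_pos.2 (hRpos t)).le) ⟨0, ⟨le_rfl, by linarith⟩, inv_pos.2 (hRpos 0)⟩
  have hi1 : ∀ a, ∫ t in a..a + T, (R t)⁻¹ = J := fun a =>
    Function.Periodic.intervalIntegral_add_eq (f := fun t => (R t)⁻¹)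
      (fun t => by simp only [hRT t]) a 0
  have hi2 : ∫ t in (0 : ℝ)..0 + T, (R t ^ 2)⁻¹ = k * J := by
    rw [← hi1 0, ← integral_comp_lift hhc hτ hτT hRic (fun t => by simp only [hRT t]) 0,
      ← intervalIntegral.integral_const_mul]
    refine intervalIntegral.integral_congr fun t _ => ?_
    have h1 := hR0 t
    have h2 := hR0 (τ t)
    simp only [hh]
    field_simp
  have hi3 : ∀ a, ∫ t in a..a + T, h t = T := fun a => by
    simpa using integral_comp_lift hhc hτ hτT (continuous_const (y := (1 : ℝ))) (fun _ => rfl) a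
  have hi4 : ∀ a, ∫ t in a..a + T, (-k⁻¹ + k⁻¹ ^ 2 * (h t * (R t)⁻¹)) = 0 := fun a => by
    rw [intervalIntegral.integral_eq_sub_of_hasDerivAt (fun t _ => hR2 t)
      (Continuous.intervalIntegrable (by fun_prop (disch := simp [hR0])) _ _),
      hT.antiperiodic, hPT, hw.neg]
    simp
  -- the Wirtinger inequality for `R - R a`
  have hq : ∀ a, T - 2 * k * T * R a + k * J * R a ^ 2 ≤ 0 := fun a => by
    have hW := hηhalf.integral_mul_nonpos halt (ρ := fun t => k⁻¹ * (R t)⁻¹) (by fun_prop) hη hη2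
      (fun t => by
        rw [map_smul, smul_eq_mul]
        exact mul_ne_zero (neg_ne_zero.2 (inv_ne_zero hk.ne')) (by rw [hησ]; norm_num))
      (D := fun t => R t - R a) (fun t => (hR1 t).sub_const _) hR2 (by fun_prop) (a := a)
      (by simp) (by simp [hRT a])
    have e : ∀ t, (R t - R a) * (-k⁻¹ + k⁻¹ ^ 2 * (h t * (R t)⁻¹) +
        k⁻¹ * (R t)⁻¹ * (R t - R a)) = k⁻¹ ^ 2 * h t - 2 * R a * k⁻¹ +
          (k⁻¹ * R a ^ 2 * (R t)⁻¹ - R a * (-k⁻¹ + k⁻¹ ^ 2 * (h t * (R t)⁻¹))) := by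
      intro t
      have := hR0 t
      field_simp
      ring
    simp_rw [e] at hW
    rw [intervalIntegral.integral_add, intervalIntegral.integral_sub,
      intervalIntegral.integral_sub, intervalIntegral.integral_const_mul,
      intervalIntegral.integral_const_mul, intervalIntegral.integral_const_mul,
      intervalIntegral.integral_const_mul, hi1, hi3, hi4,
      intervalIntegral.integral_const, add_sub_cancel_left, smul_eq_mul] at hW
    · have h1 : k ^ 2 * (k⁻¹ ^ 2 * T - 2 * R a * (T * k⁻¹) + (k⁻¹ * R a ^ 2 * J - R a * 0)) ≤ 0 :=
        mul_nonpos_of_nonneg_of_nonpos (by positivity) hW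
      refine le_trans (le_of_eq ?_) h1
      field_simp
      ring
    all_goals exact Continuous.intervalIntegrable (by fun_prop) _ _
  -- weighted with `1 / R²`, the mean value of the quadratic polynomial in `hq` is zero
  have hq0 : ∀ t, T + -(2 * k * T) * R t + k * J * R t ^ 2 = 0 := fun t => by
    have e : ∀ t, -(T - 2 * k * T * R t + k * J * R t ^ 2) * (R t ^ 2)⁻¹ =
        2 * k * T * (R t)⁻¹ - T * (R t ^ 2)⁻¹ - k * J := by
      intro t
      have := hR0 t
      field_simp
      ring
    have hz : ∫ t in (0 : ℝ)..0 + T, -(T - 2 * k * T * R t + k * J * R t ^ 2) * (R t ^ 2)⁻¹ ≤ 0 := by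
      simp_rw [e]
      rw [intervalIntegral.integral_sub, intervalIntegral.integral_sub,
        intervalIntegral.integral_const_mul, intervalIntegral.integral_const_mul, hi1, hi2,
        intervalIntegral.integral_const, smul_eq_mul]
      · exact le_of_eq (by ring)
      all_goals exact Continuous.intervalIntegrable (by fun_prop (disch := simp [hR0])) _ _
    have h1 := eq_zero_of_integral_nonpos hTpos (by fun_prop (disch := simp [hR0]))
      (fun t => by simp only [hRT t])
      (fun t => mul_nonneg (neg_nonneg.2 (hq t)) (inv_nonneg.2 (sq_nonneg _))) hz t
    have h2 := (mul_eq_zero.1 h1).resolve_right (inv_ne_zero (pow_ne_zero 2 (hR0 t)))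
    linarith
  have hconst := eq_of_forall_quadratic_eq_zero hRc (mul_pos hk hJpos).ne' hq0
  have hκ : 0 < k⁻¹ * (R 0)⁻¹ := mul_pos (inv_pos.2 hk) (inv_pos.2 (hRpos 0))
  refine isEuclidean_of_harmonic hdim (Real.sqrt_pos.2 hκ) (χ := P) hσ' (fun t => ?_)
    hσ.norm_eq_one
  have h1 : HasDerivAt P ((R 0)⁻¹ • -k⁻¹ • σ t) t :=
    ((hη t).const_smul (R 0)⁻¹).congr_of_eventuallyEq
      (Eventually.of_forall fun s => by simp only [P, hconst s 0]; rfl)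
  refine h1.congr_deriv ?_
  rw [Real.sq_sqrt hκ.le]
  module

end ArcLength

/-! ### Constant curvature of the unit circle and of the anti-circle -/

end NormedPlane

theorem theorem6p2 {X : Type*} [NormedAddCommGroup X] [NormedSpace ℝ X] [StrictConvexSpace ℝ X]
    (hdim : Module.finrank ℝ X = 2)
    (hC2 : ∀ x : X, x ≠ 0 → ContDiffAt ℝ 2 (fun y : X => ‖y‖) x)
    (ω : LinearMap.BilinForm ℝ X) (halt : ω.IsAlt) (hnd : ω.Nondegenerate) :
    (NormedPlane.HasConstantMinkowskiCurvature ω (NormedPlane.unitCircle X) →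
      NormedPlane.IsEuclidean X) ∧
    (NormedPlane.HasConstantArcLengthCurvature ω (NormedPlane.unitAntiCircle ω) →
      NormedPlane.IsEuclidean X) := by
  have : FiniteDimensional ℝ X := FiniteDimensional.of_finrank_pos (by omega)
  obtain ⟨w, hw⟩ := NormedPlane.exists_isTangentField hdim hC2 halt hnd
  -- for a curve that is traversed in the negative direction, `-ψ` and `-k` take over
  have hneg : ∀ {c ψ : ℝ → X} {k : ℝ}, (∀ t, HasDerivAt ψ (k⁻¹ • c t) t) →
      ∀ t, HasDerivAt (-ψ) ((-k)⁻¹ • c t) t := fun h t => by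
    rw [inv_neg, neg_smul]
    exact (h t).neg
  constructor
  · rintro ⟨γ, l, k, hγ, -, φ, hφ, u, hu⟩
    have hflow := hφ.isCircleFlow hw hdim halt
    obtain ⟨T, hT⟩ := hflow.exists_isHalfPeriod hdim halt hnd
    obtain ⟨hk, ψ, hψ, hψS, hψT, hpos⟩ := NormedPlane.exists_antiperiodic_extension halt
      hflow.continuous hT (B := NormedPlane.unitCircle X) (by simp [NormedPlane.unitCircle])
      ⟨φ 0, hflow.norm_eq_one 0⟩ (fun x hx => (norm_neg x).trans hx)
      (isBounded_iff_forall_norm_le.2 ⟨1, fun x hx => le_of_eq hx⟩) hγ.image_eq hγ.closed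
      (fun s hs => (hu s hs).1) fun s hs => (hu s hs).2
    rcases lt_or_gt_of_ne hk with hk | hk
    · refine NormedPlane.isEuclidean_of_mem_unitCircle hw hdim halt hflow hT (neg_pos.2 hk)
        (hneg hψ) (fun t => (norm_neg _).trans (hψS t))
        (fun t => congrArg Neg.neg (hψT t)) fun t => ?_
      rw [Pi.neg_apply, map_neg, LinearMap.neg_apply]
      exact neg_pos.2 (neg_of_mul_pos_right (hpos t) hk.le)
    · exact NormedPlane.isEuclidean_of_mem_unitCircle hw hdim halt hflow hT hk hψ hψS hψT
        fun t => pos_of_mul_pos_right (hpos t) hk.le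
  · rintro ⟨γ, l, k, hγ, -, σ, hσ, u, hu⟩
    have hflow := hσ.isCircleFlow hw hdim halt
    obtain ⟨T, hT⟩ := hflow.exists_isHalfPeriod hdim halt hnd
    obtain ⟨hk, ψ, hψ, hψS, hψT, hpos⟩ := NormedPlane.exists_antiperiodic_extension halt
      hflow.continuous hT (B := NormedPlane.unitAntiCircle ω)
      NormedPlane.zero_notMem_unitAntiCircle
      ⟨_, NormedPlane.mem_unitAntiCircle hw halt (hflow.norm_eq_one 0)⟩
      (fun x hx => NormedPlane.neg_mem_unitAntiCircle hx)
      (NormedPlane.isBounded_unitAntiCircle hw hdim halt) hγ.image_eq hγ.closed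
      (fun s hs => (hu s hs).1) fun s hs => (hu s hs).2
    have key : ∀ {ψ : ℝ → X} {k : ℝ}, 0 < k → (∀ t, HasDerivAt ψ (k⁻¹ • σ t) t) →
        (∀ t, ψ t ∈ NormedPlane.unitAntiCircle ω) → (∀ t, 0 < ω (ψ t) (σ t)) →
        NormedPlane.IsEuclidean X := by
      intro ψ k hk hψ hψS hpos
      refine NormedPlane.isEuclidean_of_hasDerivAt_tangentField hw hdim halt hflow hT hk fun t => ?_
      have h1 := (hψ t).neg
      rw [← neg_smul] at h1
      exact h1.congr_of_eventuallyEq (Eventually.of_forall fun s =>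
        NormedPlane.tangentField_eq_neg hw hdim halt hnd hflow hk.ne' hψ hψS hpos s)
    rcases lt_or_gt_of_ne hk with hk | hk
    · refine key (neg_pos.2 hk) (hneg hψ)
        (fun t => NormedPlane.neg_mem_unitAntiCircle (hψS t)) fun t => ?_
      rw [Pi.neg_apply, map_neg, LinearMap.neg_apply]
      exact neg_pos.2 (neg_of_mul_pos_right (hpos t) hk.le)
    · exact key hk hψ hψS fun t => pos_of_mul_pos_right (hpos t) hk.le
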